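/- Consider a buyer in a first-price auction with value $v\in[0,1]$ drawn from a distribution $F\in\Delta([0,1])$, the set of Borel probability measures on $[0,1]$; write $F(x)=F([0,x])$ for its CDF and $F^-(t)=\inf\{x\in[0,1] : F(x)\ge t\}$ for its generalized inverse. A bidding strategy $s\in\mathcal S$ is a Markov kernel $v\mapsto s(v)\in\Delta([0,1])$. For $H\in\Delta([0,1])$ (the distribution of the highest competing bid $h$, independent of value and bid) let $$U_F(s,H)=\mathbb E_{(v,h)\sim F\times H}\,\mathbb E_{b\sim s(v)}\big[(v-b)\mathbf 1\{b\ge h\}\big],\qquad \mathrm{Reg}_F(s,H)=\sup_{s'\in\mathcal S}U_F(s',H)-U_F(s,H).$$ A strategy is minimax optimal for $F$ if it minimizes $\sup_{H\in\Delta([0,1])}\mathrm{Reg}_F(s,H)$ over $s\in\mathcal S$. For a strictly increasing, absolutely continuous $Q:[0,1]\to[0,1]$, let $s_Q$ be the strategy, depending on $F$, defined as follows. Put $Y(v)=\{y\in[0,1]: F^-(y)=v\}$, a set of Lebesgue measure $\lambda(Y(v))=F(\{v\})$. If $\lambda(Y(v))=0$, then $s_Q(v)=\delta_{Q(F(v))}$;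 otherwise $s_Q(v)$ is the law of $Q(y)$ for $y$ uniform on $Y(v)$. Let $\tilde F\in\Delta([0,1])$ with $a:=\tilde F(\{0\})<1$, and let $F$ be $\tilde F$ conditioned on $v\neq0$, i.e. $F(t)=(\tilde F(t)-a)/(1-a)$. Then there is a strictly increasing, absolutely continuous function $Q^*:[0,1]\to[0,1]$ with $Q^*(0)=0$, with $0<Q^*(y)<F^-(y)$ for all $y\in(0,1]$, and with $$(Q^*)'(y)=\frac{F^-(y)-Q^*(y)}{1-F(Q^*(y))}\quad\text{for almost every } y\in[0,1].$$ For every such $Q^*$, the strategy $s_{Q^*}$ (built for $F$) is minimax optimal for $F$, the strategy $$\tilde s_{Q^*}(v)=\begin{cases}\delta_0 & v=0,\\ s_{Q^*}(v) & v\in(0,1],\end{cases}$$ is minimax optimal for $\tilde F$, and $$\sup_{H\in\Delta([0,1])}\mathrm{Reg}_{\tilde F}(\tilde s_{Q^*},H)=\inf_{s\in\mathcal S}\ \sup_{H\in\Delta([0,1])}\mathrm{Reg}_{\tilde F}(s,H)=(1-a)\cdot\sup_{H\in\Delta([0,1])}\mathrm{Reg}_F(s_{Q^*},H).$$ -/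

import Mathlib

open MeasureTheory ProbabilityTheory
open scoped unitInterval

noncomputable section

namespace FirstPrice

/-- The cumulative distribution function `x ↦ F([0, x])` of a distribution `F` on `[0, 1]`. -/
def cdf (F : ProbabilityMeasure I) (x : I) : ℝ := (F : Measure I).real (Set.Iic x)

/-- The generalized inverse `F⁻(t) = inf {x ∈ [0, 1] | F(x) ≥ t}`, for `t ∈ [0, 1]`.
The set is never empty, because `F(1) = 1`. -/
def quantile (F : ProbabilityMeasure I) (t : I) : I := sInf {x : I | (t : ℝ) ≤ cdf F x}

/-- Bidding strategies: Markov kernels from values in `[0, 1]` to bids in `[0, 1]`. -/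
abbrev Strategy : Type := {s : Kernel I I // IsMarkovKernel s}

/-- The utility `u(b, h; v) = (v - b) 𝟙{b ≥ h}` of bidding `b` at value `v` when the highest
competing bid is `h`. -/
def utility (b h v : I) : ℝ := if h ≤ b then (v : ℝ) - b else 0

/-- The expected utility `U_F(s, H)`. The integrand takes its values in `[-1, 1]`. -/
def expUtility (F : ProbabilityMeasure I) (s : Strategy) (H : ProbabilityMeasure I) : ℝ :=
  ∫ p : I × I, (∫ b, utility b p.2 p.1 ∂(s.1 p.1)) ∂((F : Measure I).prod (H : Measure I))

/-- `Reg_F(s, H) = sup_{s'} U_F(s', H) - U_F(s, H)`. The supremum is over a non-empty set of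
reals that is contained in `[-1, 1]`. -/
def regret (F : ProbabilityMeasure I) (s : Strategy) (H : ProbabilityMeasure I) : ℝ :=
  (⨆ s' : Strategy, expUtility F s' H) - expUtility F s H

/-- The worst-case regret `sup_H Reg_F(s, H)`; all regrets lie in `[0, 2]`. -/
def worstRegret (F : ProbabilityMeasure I) (s : Strategy) : ℝ :=
  ⨆ H : ProbabilityMeasure I, regret F s H

/-- The minimax regret `inf_s sup_H Reg_F(s, H)`. -/
def minimaxRegret (F : ProbabilityMeasure I) : ℝ := ⨅ s : Strategy, worstRegret F s

/-- `s` attains the minimum of the worst-case regret over all bidding strategies. -/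
def IsMinimaxOptimal (F : ProbabilityMeasure I) (s : Strategy) : Prop :=
  ∀ s' : Strategy, worstRegret F s ≤ worstRegret F s'

/-- A function `[0, 1] → [0, 1]`, as a real function (constant to the left and to the right of
`[0, 1]`). -/
def extend (Q : I → I) : ℝ → ℝ := Set.IccExtend (zero_le_one' ℝ) fun y => (Q y : ℝ)

/-- Quantile-based bidding strategies: strictly increasing, absolutely continuous functions
from `[0, 1]` to itself. -/
structure QuantileStrategy where
  /-- The bid at each quantile. -/
  toFun : I → I
  strictMono : StrictMono toFun
  absolutelyContinuous : AbsolutelyContinuousOnInterval (extend toFun) 0 1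

instance : CoeFun QuantileStrategy fun _ => I → I := ⟨QuantileStrategy.toFun⟩

/-- The set `Y(v) = {y ∈ [0, 1] | F⁻(y) = v}` of the quantiles of the value `v`. -/
def quantileSet (F : ProbabilityMeasure I) (v : I) : Set I := {y | quantile F y = v}

theorem cdf_mono (F : ProbabilityMeasure I) : Monotone (cdf F) := fun _ _ h =>
  measureReal_mono (Set.Iic_subset_Iic.2 h)

theorem cdf_mem (F : ProbabilityMeasure I) (x : I) : cdf F x ∈ Set.Icc (0 : ℝ) 1 :=
  ⟨measureReal_nonneg, measureReal_le_one⟩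

theorem quantile_mono (F : ProbabilityMeasure I) : Monotone (quantile F) := fun _ _ h =>
  sInf_le_sInf fun _ hx => le_trans (Subtype.coe_le_coe.2 h) hx

theorem measurableSet_quantileSet (F : ProbabilityMeasure I) (v : I) :
    MeasurableSet (quantileSet F v) :=
  (quantile_mono F).measurable (measurableSet_singleton v)

theorem countable_quantileSet_pos (F : ProbabilityMeasure I) :
    {v : I | volume (quantileSet F v) ≠ 0}.Countable := by
  have h := Measure.countable_meas_pos_of_disjoint_iUnion (μ := (volume : Measure I))
    (As := quantileSet F) (measurableSet_quantileSet F) (by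
      intro v w hvw
      refine Set.disjoint_left.2 fun y hy hy' => hvw ?_
      exact hy.symm.trans hy')
  simpa [pos_iff_ne_zero] using h

/-- The distribution of the bid of `s_Q` at value `v`: the bid `Q(F(v))` if the set `Y(v)` is
Lebesgue-null, and the law of `Q(y)` for `y` uniform on `Y(v)` otherwise. Recall that
`λ(Y(v)) = F({v})`. -/
def bidLaw (F : ProbabilityMeasure I) (Q : QuantileStrategy) (v : I) : Measure I :=
  open Classical in
  if volume (quantileSet F v) = 0 then Measure.dirac (Q ⟨cdf F v, cdf_mem F v⟩)
  else ((volume : Measure I)[|quantileSet F v]).map Q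

theorem QuantileStrategy.measurable (Q : QuantileStrategy) : Measurable Q :=
  Q.strictMono.monotone.measurable

theorem measurable_bidLaw (F : ProbabilityMeasure I) (Q : QuantileStrategy) :
    Measurable (bidLaw F Q) := by
  have h1 : Measurable fun v : I => Measure.dirac (Q ⟨cdf F v, cdf_mem F v⟩) :=
    Measure.measurable_dirac.comp
      (Q.measurable.comp ((cdf_mono F).measurable.subtype_mk))
  refine h1.measurable_of_countable_ne ((countable_quantileSet_pos F).mono fun v hv => ?_)
  intro h0
  exact hv (by simp [bidLaw, h0])

theorem isProbabilityMeasure_bidLaw (F : ProbabilityMeasure I) (Q : QuantileStrategy) (v : I) :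
    IsProbabilityMeasure (bidLaw F Q v) := by
  unfold bidLaw
  split_ifs with h
  · infer_instance
  · have := cond_isProbabilityMeasure h
    exact Measure.isProbabilityMeasure_map Q.measurable.aemeasurable

/-- The bidding strategy `s_Q` of a quantile-based bidding strategy `Q`, for the value
distribution `F`. -/
def quantileBidding (F : ProbabilityMeasure I) (Q : QuantileStrategy) : Strategy :=
  ⟨⟨bidLaw F Q, measurable_bidLaw F Q⟩, ⟨isProbabilityMeasure_bidLaw F Q⟩⟩

/-- `Q` is an (almost everywhere) solution `Q*` of the initial value problem
`x'(t) = (F⁻(t) - x(t)) / (1 - F(x(t)))`, `x(0) = 0`, with `0 < Q(y) < F⁻(y)` for `y > 0`. -/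
structure IsSolution (F : ProbabilityMeasure I) (Q : QuantileStrategy) : Prop where
  ode : ∀ᵐ y : I, HasDerivAt (extend Q)
    (((quantile F y : ℝ) - Q y) / (1 - cdf F (Q y))) (y : ℝ)
  zero : Q 0 = 0
  pos : ∀ y : I, 0 < y → 0 < Q y
  lt_quantile : ∀ y : I, 0 < y → Q y < quantile F y

/-- The distribution of `v ∼ F` conditioned on `v ≠ 0`. -/
def condPos (F : ProbabilityMeasure I) (h : (F : Measure I).real {0} < 1) :
    ProbabilityMeasure I :=
  ⟨(F : Measure I)[|{0}ᶜ], cond_isProbabilityMeasure fun h0 => by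
    have h1 := probReal_compl_eq_one_sub (μ := (F : Measure I)) (measurableSet_singleton 0)
    rw [measureReal_def, h0, ENNReal.toReal_zero] at h1
    linarith⟩

/-- The strategy that bids `0` at value `0` and follows `s` at all other values. -/
def bidZeroAtZero (s : Strategy) : Strategy :=
  open Classical in
  ⟨Kernel.piecewise (measurableSet_singleton (0 : I)) (Kernel.const I (Measure.dirac 0)) s.1, by
    have := s.2
    infer_instance⟩

end FirstPrice

end

/-! Write `G(x) = ∫₀ˣ (1 - F)`. By linearity in `H`, the worst-case regret of a strategy is governed
by its regret against deterministic competing bids `h`, where the best response earns `∫ (F⁻ - h)⁺ =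
G(1) - G(h)`.

Upper bound. Value and bid under `s_Q` are distributed as `(F⁻(y), Q(y))` for uniform `y`
(`integral_bidLaw`). The differential equation says `(G ∘ Q)' = F⁻ - Q`, so `G(Q(x)) = ∫₀ˣ (F⁻ -
Q)`, whereas `s_Q` earns `∫ₓ¹ (F⁻ - Q)` against `h = Q(x)`. Since `G(1) = ∫ F⁻`, the regret equals
`R = ∫ Q` for every `h` in the range `[0, Q(1)]` (`surplus_bid_eq`), and it is no larger for higher
`h`.

Lower bound. Let the competing bid be `Q(x)` with `x` having CDF `M(y) = exp(-∫_y¹ 1 / (1 - F(Q)))`.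
The payoff `(v - Q(z)) M(z)` of value `v = F⁻(y)` has derivative in `z` a nonnegative multiple of `v
- F⁻(z)`, hence is maximal at `z = y`. So `s_Q` is a best response to this distribution, against
which its regret is exactly `R`; every other strategy has average regret at least `R` there
(`le_worstRegret`).

Existence. The integrated equation `G(Q(t)) = ∫₀ᵗ (F⁻ - Q)` degenerates where `F = 1`, so `1 - F` is
first replaced by `max (1 - F) k`. The modified `G` has a Lipschitz inverse and Picard–Lindelöf
applies. A lower bound on `∫ Q` that does not depend on `k` then shows that, for suitable `k`, the
solution never reaches the region where the truncation acts (`exists_real_solution`).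

Atom at zero. Value `0` can never gain from winning, and bidding `0` gives it utility `0`. Thus
worst-case regrets for `F̃` are at least `1 - a` times those for `F`, and bidding `0` at value `0`
attains this factor. -/

noncomputable section

namespace FirstPrice

/-! ### Quantiles, the CDF and the integrated survival function -/

section

/-- The quantile function as a real function, constant outside `[0, 1]`. -/
def quantileReal (F : ProbabilityMeasure I) (t : ℝ) : ℝ :=
  quantile F (Set.projIcc 0 1 zero_le_one t)

/-- The CDF as a real function, constant outside `[0, 1]`. -/
def cdfReal (F : ProbabilityMeasure I) (x : ℝ) : ℝ := cdf F (Set.projIcc 0 1 zero_le_one x)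

/-- The integrated survival function `x ↦ ∫₀ˣ (1 - F)`. -/
def intSurvival (F : ProbabilityMeasure I) (x : ℝ) : ℝ := ∫ t in (0 : ℝ)..x, (1 - cdfReal F t)

variable (F : ProbabilityMeasure I)

theorem quantileReal_coe (y : I) : quantileReal F y = quantile F y := by
  simp [quantileReal]

theorem cdfReal_coe (y : I) : cdfReal F y = cdf F y := by
  simp [cdfReal]

theorem quantileReal_mono : Monotone (quantileReal F) := fun _ _ h =>
  quantile_mono F (Set.monotone_projIcc _ h)

theorem cdfReal_mono : Monotone (cdfReal F) := fun _ _ h =>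
  cdf_mono F (Set.monotone_projIcc _ h)

theorem quantileReal_nonneg (t : ℝ) : 0 ≤ quantileReal F t := (quantile F _).2.1

theorem quantileReal_le_one (t : ℝ) : quantileReal F t ≤ 1 := (quantile F _).2.2

theorem cdfReal_nonneg (t : ℝ) : 0 ≤ cdfReal F t := (cdf_mem F _).1

theorem cdfReal_le_one (t : ℝ) : cdfReal F t ≤ 1 := (cdf_mem F _).2

theorem cdf_one : cdf F 1 = 1 := by
  have : Set.Iic (1 : I) = Set.univ := by
    ext x; simp [unitInterval.le_one']
  simp [cdf, this]

/-- The CDF is right-continuous (continuity from above of the measure), so the infimum defining the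
quantile is attained. This yields the Galois connection `quantile_le_iff`. -/
theorem le_cdf_quantile (t : I) : (t : ℝ) ≤ cdf F (quantile F t) := by
  set S : Set I := {x : I | (t : ℝ) ≤ cdf F x}
  have hne : S.Nonempty := ⟨1, by simp [S, cdf_one, t.2.2]⟩
  obtain ⟨u, hu, hlim, hmem⟩ := exists_seq_tendsto_sInf hne (OrderBot.bddBelow S)
  have hI : (⋂ n, Set.Iic (u n)) = Set.Iic (sInf S) := by
    ext x
    simp only [Set.mem_iInter, Set.mem_Iic]
    exact ⟨fun h => ge_of_tendsto' hlim h, fun h n => h.trans (sInf_le (hmem n))⟩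
  have h := tendsto_measure_iInter_atTop (μ := (F : Measure I)) (s := fun n => Set.Iic (u n))
    (fun n => measurableSet_Iic.nullMeasurableSet) (fun a b hab => Set.Iic_subset_Iic.2 (hu hab))
    ⟨0, measure_ne_top _ _⟩
  rw [hI] at h
  have h' := (ENNReal.tendsto_toReal (measure_ne_top (F : Measure I) _)).comp h
  exact ge_of_tendsto' h' fun n => hmem n

theorem quantile_le_iff (t x : I) : quantile F t ≤ x ↔ (t : ℝ) ≤ cdf F x :=
  ⟨fun h => (le_cdf_quantile F t).trans (cdf_mono F h), fun h => sInf_le h⟩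

theorem quantileReal_le_iff {t x : ℝ} (ht : t ∈ Set.Icc (0 : ℝ) 1) (hx : x ∈ Set.Icc (0 : ℝ) 1) :
    quantileReal F t ≤ x ↔ t ≤ cdfReal F x := by
  lift t to I using ht
  lift x to I using hx
  rw [quantileReal_coe, cdfReal_coe, ← quantile_le_iff]
  rfl

/-- The value distribution is the law of the quantile function. -/
theorem map_quantile : (volume : Measure I).map (quantile F) = (F : Measure I) := by
  refine Measure.ext_of_Iic _ _ fun x => ?_
  rw [Measure.map_apply (quantile_mono F).measurable measurableSet_Iic]
  have : quantile F ⁻¹' Set.Iic x = Set.Iic ⟨cdf F x, cdf_mem F x⟩ := by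
    ext t
    simp only [Set.mem_preimage, Set.mem_Iic, quantile_le_iff]
    rfl
  rw [this, unitInterval.volume_Iic]
  exact ofReal_measureReal

theorem integral_eq_integral_quantile {f : I → ℝ} (hf : Measurable f) :
    ∫ v, f v ∂(F : Measure I) = ∫ y : I, f (quantile F y) := by
  conv_lhs => rw [← map_quantile F]
  exact integral_map (quantile_mono F).measurable.aemeasurable hf.aestronglyMeasurable

/-- Integrals over the unit interval are interval integrals. -/
theorem integral_coe_eq_intervalIntegral (f : ℝ → ℝ) :
    ∫ y : I, f y = ∫ t in (0 : ℝ)..1, f t := by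
  rw [intervalIntegral.integral_of_le zero_le_one, ← integral_Icc_eq_integral_Ioc]
  exact integral_subtype measurableSet_Icc f

theorem ae_coe_iff {p : ℝ → Prop} :
    (∀ᵐ y : I, p y) ↔ ∀ᵐ t : ℝ, t ∈ Set.Icc (0 : ℝ) 1 → p t :=
  (ae_restrict_iff_subtype measurableSet_Icc).symm.trans (ae_restrict_iff' measurableSet_Icc)

theorem intervalIntegrable_quantileReal (a b : ℝ) :
    IntervalIntegrable (quantileReal F) volume a b := (quantileReal_mono F).intervalIntegrable

theorem intervalIntegrable_survival (a b : ℝ) :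
    IntervalIntegrable (fun t => 1 - cdfReal F t) volume a b :=
  intervalIntegrable_const.sub (cdfReal_mono F).intervalIntegrable

theorem intSurvival_sub (a b : ℝ) :
    intSurvival F b - intSurvival F a = ∫ t in a..b, (1 - cdfReal F t) :=
  intervalIntegral.integral_interval_sub_left (intervalIntegrable_survival F _ _)
    (intervalIntegrable_survival F _ _)

theorem intSurvival_zero : intSurvival F 0 = 0 := by simp [intSurvival]

theorem intSurvival_mono : Monotone (intSurvival F) := fun a b h => by
  have := intSurvival_sub F a b
  have h2 : 0 ≤ ∫ t in a..b, (1 - cdfReal F t) :=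
    intervalIntegral.integral_nonneg h fun t _ => sub_nonneg.2 (cdfReal_le_one F t)
  linarith

theorem intSurvival_sub_le {a b : ℝ} (h : a ≤ b) :
    intSurvival F b - intSurvival F a ≤ b - a := by
  rw [intSurvival_sub]
  calc _ ≤ ∫ t in a..b, (1 : ℝ) := intervalIntegral.integral_mono_on h
        (intervalIntegrable_survival F _ _) intervalIntegrable_const
        fun t _ => by linarith [cdfReal_nonneg F t]
    _ = b - a := by simp

theorem lipschitzWith_intSurvival : LipschitzWith 1 (intSurvival F) := by
  refine LipschitzWith.of_le_add fun a b => ?_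
  rcases le_total a b with h | h
  · linarith [intSurvival_mono F h, dist_nonneg (x := a) (y := b)]
  · have := intSurvival_sub_le F h
    rw [Real.dist_eq, abs_of_nonneg (by linarith)]
    linarith

theorem hasDerivAt_intSurvival {x : ℝ} (hx : ContinuousAt (cdfReal F) x) :
    HasDerivAt (intSurvival F) (1 - cdfReal F x) x :=
  intervalIntegral.integral_hasDerivAt_right (intervalIntegrable_survival F _ _)
    (measurable_const.sub (cdfReal_mono F).measurable).stronglyMeasurable.stronglyMeasurableAtFilter
    (continuousAt_const.sub hx)

/-- The expected surplus over a price `h`. -/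
theorem integral_max_quantileReal_sub {h : ℝ} (hh : h ∈ Set.Icc (0 : ℝ) 1) :
    ∫ t in (0 : ℝ)..1, max (quantileReal F t - h) 0 = intSurvival F 1 - intSurvival F h := by
  -- Layer-cake representation: the surplus is the length of the set of `x` in `[h, 1]` below the
  -- quantile. Fubini then exchanges prices and quantiles.
  have e1 : ∀ t ∈ Set.Icc (0 : ℝ) 1, max (quantileReal F t - h) 0 =
      ∫ x in h..1, if cdfReal F x < t then (1 : ℝ) else 0 := fun t ht => by
    have key : ∀ x ∈ Set.Icc h 1, (if cdfReal F x < t then (1 : ℝ) else 0) =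
        (Set.Iio (quantileReal F t)).indicator 1 x := fun x hx => by
      have := quantileReal_le_iff F ht (x := x) ⟨hh.1.trans hx.1, hx.2⟩
      simp only [Set.indicator_apply, Set.mem_Iio, ← not_le, this, Pi.one_apply]
    rw [intervalIntegral.integral_congr (g := (Set.Iio (quantileReal F t)).indicator 1)
      fun x hx => key x (by rwa [Set.uIcc_of_le hh.2] at hx),
      intervalIntegral.integral_of_le hh.2, integral_indicator_one measurableSet_Iio,
      measureReal_restrict_apply measurableSet_Iio, measureReal_congr (t := Set.Ioc h (quantileReal F t))]
    · rw [Real.volume_real_Ioc]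
    · have h1 : Set.Iic (quantileReal F t) ∩ Set.Ioc h 1 = Set.Ioc h (quantileReal F t) := by
        ext x
        have := quantileReal_le_one F t
        simp only [Set.mem_inter_iff, Set.mem_Iic, Set.mem_Ioc]
        grind
      rw [← h1]
      exact Iio_ae_eq_Iic.inter (Filter.EventuallyEq.refl _ _)
  rw [intervalIntegral.integral_congr fun t ht => e1 t (by rwa [Set.uIcc_of_le zero_le_one] at ht),
    intSurvival_sub]
  have e2 : ∀ x ∈ Set.uIcc h 1, (∫ t in (0 : ℝ)..1, if cdfReal F x < t then (1 : ℝ) else 0) =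
      1 - cdfReal F x := fun x _ => by
    have : (fun t => if cdfReal F x < t then (1 : ℝ) else 0) =
        (Set.Ioi (cdfReal F x)).indicator 1 := by
      ext t; simp [Set.indicator_apply]
    rw [this, intervalIntegral.integral_of_le zero_le_one, integral_indicator_one measurableSet_Ioi,
      measureReal_restrict_apply measurableSet_Ioi, Set.inter_comm, Set.Ioc_inter_Ioi,
      max_eq_right (cdfReal_nonneg F x), Real.volume_real_Ioc_of_le (cdfReal_le_one F x)]
  rw [← intervalIntegral.integral_congr e2]
  simp only [intervalIntegral.integral_of_le zero_le_one, intervalIntegral.integral_of_le hh.2]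
  refine integral_integral_swap ?_
  have hm : Measurable (Function.uncurry fun t x => if cdfReal F x < t then (1 : ℝ) else 0) :=
    Measurable.ite (measurableSet_lt ((cdfReal_mono F).measurable.comp measurable_snd) measurable_fst)
      measurable_const measurable_const
  refine Integrable.of_bound hm.aestronglyMeasurable 1 (Filter.Eventually.of_forall fun p => ?_)
  simp only [Function.uncurry]
  split_ifs <;> simp

theorem integral_quantileReal : ∫ t in (0 : ℝ)..1, quantileReal F t = intSurvival F 1 := by
  have := integral_max_quantileReal_sub F (h := 0) ⟨le_rfl, zero_le_one⟩
  simpa [intSurvival_zero, quantileReal_nonneg] using this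

/-- Subtract the surplus over the price `F⁻(T)` from the mean: quantiles below `T` contribute no
surplus, and those above contribute at most their value. This keeps solutions below `F⁻`. -/
theorem integral_quantileReal_le {T : ℝ} (hT : T ∈ Set.Icc (0 : ℝ) 1) :
    ∫ t in (0 : ℝ)..T, quantileReal F t ≤ intSurvival F (quantileReal F T) := by
  have h1 := integral_max_quantileReal_sub F (h := quantileReal F T)
    ⟨quantileReal_nonneg F T, quantileReal_le_one F T⟩
  have hmax : Monotone fun t => max (quantileReal F t - quantileReal F T) 0 := fun a b hab =>
    max_le_max (sub_le_sub_right (quantileReal_mono F hab) _) le_rfl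
  rw [← intervalIntegral.integral_add_adjacent_intervals (b := T) hmax.intervalIntegrable
    hmax.intervalIntegrable] at h1
  have h2 : ∫ t in (0 : ℝ)..T, max (quantileReal F t - quantileReal F T) 0 = 0 := by
    rw [intervalIntegral.integral_congr (g := fun _ => 0) fun t ht => ?_]
    · simp
    · rw [Set.uIcc_of_le hT.1] at ht
      exact max_eq_right (sub_nonpos.2 (quantileReal_mono F ht.2))
  have h3 : ∫ t in T..1, max (quantileReal F t - quantileReal F T) 0 ≤
      ∫ t in T..1, quantileReal F t :=
    intervalIntegral.integral_mono_on hT.2 hmax.intervalIntegrable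
      (intervalIntegrable_quantileReal F _ _) fun t _ => max_le
        (by linarith [quantileReal_nonneg F T]) (quantileReal_nonneg F t)
  have h4 := intervalIntegral.integral_add_adjacent_intervals
    (intervalIntegrable_quantileReal F 0 T) (intervalIntegrable_quantileReal F T 1)
  rw [integral_quantileReal] at h4
  linarith

end

/-! ### The truncated survival integral and a Picard–Lindelöf argument -/

section

variable (F : ProbabilityMeasure I)

/-- The integral of the survival function truncated from below at `k`. -/
def truncSurvival (k x : ℝ) : ℝ := ∫ t in (0 : ℝ)..x, max (1 - cdfReal F t) k

theorem antitone_max_survival (k : ℝ) : Antitone fun t => max (1 - cdfReal F t) k :=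
  fun _ _ h => max_le_max (sub_le_sub_left (cdfReal_mono F h) _) le_rfl

theorem truncSurvival_sub (k a b : ℝ) :
    truncSurvival F k b - truncSurvival F k a = ∫ t in a..b, max (1 - cdfReal F t) k :=
  intervalIntegral.integral_interval_sub_left (antitone_max_survival F k).intervalIntegrable
    (antitone_max_survival F k).intervalIntegrable

theorem truncSurvival_zero (k : ℝ) : truncSurvival F k 0 = 0 := by simp [truncSurvival]

variable {F} {k : ℝ}

theorem mul_sub_le_truncSurvival_sub {C a b : ℝ} (h : a ≤ b)
    (hC : ∀ t, a < t → t < b → C ≤ max (1 - cdfReal F t) k) :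
    C * (b - a) ≤ truncSurvival F k b - truncSurvival F k a := by
  rw [truncSurvival_sub]
  calc C * (b - a) = ∫ t in a..b, C := by simp [mul_comm]
    _ ≤ _ := intervalIntegral.integral_mono_on_of_le_Ioo h intervalIntegrable_const
        (antitone_max_survival F k).intervalIntegrable fun t ht => hC t ht.1 ht.2

theorem truncSurvival_sub_le (hk : k ≤ 1) {a b : ℝ} (h : a ≤ b) :
    truncSurvival F k b - truncSurvival F k a ≤ b - a := by
  rw [truncSurvival_sub]
  calc _ ≤ ∫ t in a..b, (1 : ℝ) := intervalIntegral.integral_mono_on h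
        (antitone_max_survival F k).intervalIntegrable intervalIntegrable_const
        fun t _ => max_le (by linarith [cdfReal_nonneg F t]) hk
    _ = b - a := by simp

theorem truncSurvival_le_self (hk : k ≤ 1) {x : ℝ} (hx : 0 ≤ x) : truncSurvival F k x ≤ x := by
  simpa [truncSurvival_zero] using truncSurvival_sub_le (F := F) hk hx

theorem intSurvival_le_truncSurvival {x : ℝ} (hx : 0 ≤ x) :
    intSurvival F x ≤ truncSurvival F k x :=
  intervalIntegral.integral_mono_on hx (intervalIntegrable_survival F _ _)
    (antitone_max_survival F k).intervalIntegrable fun _ _ => le_max_left _ _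

theorem continuous_truncSurvival : Continuous (truncSurvival F k) :=
  intervalIntegral.continuous_primitive
    (fun _ _ => (antitone_max_survival F k).intervalIntegrable) 0

theorem strictMono_truncSurvival (hk0 : 0 < k) : StrictMono (truncSurvival F k) := fun a b h => by
  have := mul_sub_le_truncSurvival_sub (F := F) (k := k) (C := k) h.le fun t _ _ => le_max_right _ _
  nlinarith [mul_pos hk0 (sub_pos.2 h)]

/-- The integrand is at least `k`, so the primitive expands distances by at least `k` and its
inverse contracts up to the factor `k⁻¹`. -/
theorem exists_inverse_truncSurvival (hk0 : 0 < k) :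
    ∃ Φ : ℝ → ℝ, LipschitzWith (Real.toNNReal k⁻¹) Φ ∧ StrictMono Φ ∧
      (∀ x, Φ (truncSurvival F k x) = x) ∧ ∀ z, truncSurvival F k (Φ z) = z := by
  have hlow : ∀ {a b : ℝ}, a ≤ b → k * (b - a) ≤ truncSurvival F k b - truncSurvival F k a :=
    fun h => mul_sub_le_truncSurvival_sub h fun t _ _ => le_max_right _ _
  have hmono := strictMono_truncSurvival (F := F) hk0
  have hsurj : Function.Surjective (truncSurvival F k) := by
    refine continuous_truncSurvival.surjective ?_ ?_
    · refine Filter.tendsto_atTop_mono' _ ?_ (Filter.tendsto_id.const_mul_atTop hk0)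
      filter_upwards [Filter.eventually_ge_atTop 0] with x hx
      simpa [truncSurvival_zero] using hlow hx
    · refine Filter.tendsto_atBot_mono' _ ?_ (Filter.tendsto_id.const_mul_atBot hk0)
      filter_upwards [Filter.eventually_le_atBot 0] with x hx
      have := hlow hx
      simp only [truncSurvival_zero] at this
      simp only [id]
      linarith
  have hr := Function.rightInverse_surjInv hsurj
  have hsm : StrictMono (Function.surjInv hsurj) := fun a b h => by
    rw [← hmono.lt_iff_lt, hr a, hr b]; exact h
  refine ⟨Function.surjInv hsurj, ?_, hsm, Function.leftInverse_surjInv ⟨hmono.injective, hsurj⟩, hr⟩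
  refine LipschitzWith.of_le_add_mul _ fun a b => ?_
  rw [Real.coe_toNNReal _ (inv_pos.2 hk0).le]
  rcases le_total a b with h | h
  · have := hsm.monotone h
    have h2 : 0 ≤ k⁻¹ * dist a b := by positivity
    linarith
  · have := hlow (hsm.monotone h)
    rw [hr, hr] at this
    rw [Real.dist_eq, abs_of_nonneg (by linarith)]
    have h2 := mul_le_mul_of_nonneg_left this (inv_pos.2 hk0).le
    rw [inv_mul_cancel_left₀ hk0.ne'] at h2
    linarith

variable (F)

theorem intervalIntegrable_quantileReal_sub {f : ℝ → ℝ} (hf : Continuous f) (a b : ℝ) :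
    IntervalIntegrable (fun s => quantileReal F s - f s) volume a b :=
  (intervalIntegrable_quantileReal F a b).sub (hf.intervalIntegrable a b)

theorem continuous_integral_quantileReal :
    Continuous fun t => ∫ s in (0 : ℝ)..t, quantileReal F s :=
  intervalIntegral.continuous_primitive (intervalIntegrable_quantileReal F) 0

/-- `F⁻` may jump, so Picard–Lindelöf is applied to `w = z - A` with `A(t) = ∫₀ᵗ F⁻`, whose vector
field is continuous in time. Clipping `Φ` to `[0, 1]` bounds the field by `1`, so the solution
exists on all of `[0, 1]`. -/
theorem exists_integral_equation {Φ : ℝ → ℝ} {K : NNReal} (hΦ : LipschitzWith K Φ) :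
    ∃ z : ℝ → ℝ, Continuous z ∧ ∀ t ∈ Set.Icc (0 : ℝ) 1,
      z t = ∫ s in (0 : ℝ)..t, (quantileReal F s - max 0 (min 1 (Φ (z s)))) := by
  set A : ℝ → ℝ := fun t => ∫ s in (0 : ℝ)..t, quantileReal F s with hA
  have hAc : Continuous A := continuous_integral_quantileReal F
  have hcl : LipschitzWith K fun x => max 0 (min 1 (Φ x)) := by
    simpa using (hΦ.const_min 1).const_max 0
  have hP : IsPicardLindelof (fun t w => -max 0 (min 1 (Φ (w + A t)))) (tmin := 0) (tmax := 1)
      ⟨0, by simp⟩ (0 : ℝ) 1 0 1 K :=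
    { lipschitzOnWith := fun t _ => by
        refine (LipschitzWith.of_dist_le_mul fun x y => ?_).lipschitzOnWith
        simpa [dist_neg_neg, dist_add_right] using hcl.dist_le_mul (x + A t) (y + A t)
      continuousOn := fun x _ =>
        (hcl.continuous.comp (continuous_const.add hAc)).neg.continuousOn
      norm_le := fun t _ x _ => by
        rw [norm_neg, Real.norm_of_nonneg (le_max_left _ _)]
        exact max_le zero_le_one (min_le_left _ _)
      mul_max_le := by simp }
  obtain ⟨w, hw0, hw⟩ := hP.exists_eq_forall_mem_Icc_hasDerivWithinAt₀
  simp only at hw0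
  have hwc : ContinuousOn w (Set.Icc 0 1) := fun t ht => (hw t ht).continuousWithinAt
  set w' : ℝ → ℝ := Set.IccExtend (zero_le_one' ℝ) fun t : Set.Icc (0 : ℝ) 1 => w t with hw'
  have hw'c : Continuous w' := (continuousOn_iff_continuous_domRestrict.1 hwc).Icc_extend'
  have hww : ∀ t ∈ Set.Icc (0 : ℝ) 1, w' t = w t := fun t ht => by
    rw [hw', Set.IccExtend_of_mem _ _ ht]
  refine ⟨fun t => w' t + A t, hw'c.add hAc, fun t ht => ?_⟩
  have hint : Continuous fun s => max 0 (min 1 (Φ (w' s + A s))) :=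
    hcl.continuous.comp (hw'c.add hAc)
  rw [intervalIntegral.integral_sub (intervalIntegrable_quantileReal F _ _)
    (hint.intervalIntegrable _ _)]
  have hsub : Set.Icc 0 t ⊆ Set.Icc (0 : ℝ) 1 := Set.Icc_subset_Icc_right ht.2
  have h := intervalIntegral.integral_eq_sub_of_hasDerivAt_of_le (f := w)
    (f' := fun s => -max 0 (min 1 (Φ (w' s + A s)))) ht.1 (hwc.mono hsub)
    (fun s hs => by
      have h1 : s ∈ Set.Icc (0 : ℝ) 1 := hsub (Set.Ioo_subset_Icc_self hs)
      have h2 := (hw s h1).hasDerivAt (Icc_mem_nhds hs.1 (hs.2.trans_le ht.2))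
      rwa [← hww s h1] at h2) (hint.neg.intervalIntegrable _ _)
  rw [intervalIntegral.integral_neg, hw0] at h
  change w' t + A t = _
  rw [hww t ht]
  linarith

end

/-! ### Existence of a solution -/

section

variable {F : ProbabilityMeasure I}

theorem quantileReal_pos (h0 : cdf F 0 = 0) {t : ℝ} (ht : t ∈ Set.Ioc (0 : ℝ) 1) :
    0 < quantileReal F t := by
  rw [← not_le, quantileReal_le_iff F ⟨ht.1.le, ht.2⟩ ⟨le_rfl, zero_le_one⟩]
  have : cdfReal F 0 = 0 := by simpa [h0] using cdfReal_coe F 0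
  rw [this]
  exact not_le.2 ht.1

theorem integral_quantileReal_pos (h0 : cdf F 0 = 0) {t : ℝ} (ht : t ∈ Set.Ioc (0 : ℝ) 1) :
    0 < ∫ s in (0 : ℝ)..t, quantileReal F s :=
  intervalIntegral.intervalIntegral_pos_of_pos_on (intervalIntegrable_quantileReal F _ _)
    (fun _ hs => quantileReal_pos h0 ⟨hs.1, hs.2.le.trans ht.2⟩) ht.1

theorem integral_quantileReal_mono {s t : ℝ} (hst : s ≤ t) :
    ∫ u in (0 : ℝ)..s, quantileReal F u ≤ ∫ u in (0 : ℝ)..t, quantileReal F u := by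
  have h1 := intervalIntegral.integral_add_adjacent_intervals
    (intervalIntegrable_quantileReal F 0 s) (intervalIntegrable_quantileReal F s t)
  have h2 : 0 ≤ ∫ u in s..t, quantileReal F u :=
    intervalIntegral.integral_nonneg hst fun u _ => quantileReal_nonneg F u
  linarith

/-- With `Q = Φ(z)` the integral equation becomes the truncated problem, once the clipping is shown
to be inactive: `0 ≤ z` and `Φ(z) ≤ F⁻`. -/
theorem exists_truncated_solution (F : ProbabilityMeasure I) {k : ℝ} (hk0 : 0 < k) :
    ∃ Q : ℝ → ℝ, Continuous Q ∧ ∀ t ∈ Set.Icc (0 : ℝ) 1, 0 ≤ Q t ∧ Q t ≤ quantileReal F t ∧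
      truncSurvival F k (Q t) = ∫ s in (0 : ℝ)..t, (quantileReal F s - Q s) := by
  obtain ⟨Φ, hΦ, hmono, hl, hr⟩ := exists_inverse_truncSurvival (F := F) hk0
  obtain ⟨z, hzc, hz⟩ := exists_integral_equation F hΦ
  have hΦ0 : Φ 0 = 0 := by simpa [truncSurvival_zero] using hl 0
  have hQc : Continuous fun s => max 0 (min 1 (Φ (z s))) :=
    continuous_const.max (continuous_const.min (hΦ.continuous.comp hzc))
  have hint := intervalIntegrable_quantileReal_sub F hQc
  have hz0 : ∀ t ∈ Set.Icc (0 : ℝ) 1, 0 ≤ z t := by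
    intro t ht
    by_contra hneg
    have hS : IsCompact (Set.Icc 0 t ∩ {s | 0 ≤ z s}) :=
      isCompact_Icc.inter_right (isClosed_le continuous_const hzc)
    have hne : (Set.Icc 0 t ∩ {s | 0 ≤ z s}).Nonempty :=
      ⟨0, ⟨le_rfl, ht.1⟩, by simp [hz 0 ⟨le_rfl, zero_le_one⟩]⟩
    -- `s₀` is the last time before `t` with `0 ≤ z`. Afterwards `z < 0`, the clipped term vanishes
    -- and `z` cannot decrease, which contradicts `z t < 0`.
    obtain ⟨s₀, ⟨hs₀, hzs₀⟩, hmax⟩ := hS.exists_isGreatest hne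
    have h1 : z t - z s₀ = ∫ s in s₀..t, (quantileReal F s - max 0 (min 1 (Φ (z s)))) := by
      rw [hz t ht, hz s₀ ⟨hs₀.1, hs₀.2.trans ht.2⟩]
      exact intervalIntegral.integral_interval_sub_left (hint _ _) (hint _ _)
    have h2 : ∫ s in s₀..t, (0 : ℝ) ≤
        ∫ s in s₀..t, (quantileReal F s - max 0 (min 1 (Φ (z s)))) := by
      refine intervalIntegral.integral_mono_on_of_le_Ioo hs₀.2 intervalIntegrable_const (hint _ _)
        fun s hs => ?_
      have hzs : z s < 0 := by
        by_contra hge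
        exact absurd (hmax ⟨⟨hs₀.1.trans hs.1.le, hs.2.le⟩, not_lt.1 hge⟩) (not_le.2 hs.1)
      have : Φ (z s) < 0 := hΦ0 ▸ hmono hzs
      rw [max_eq_left ((min_le_right _ _).trans this.le), sub_zero]
      exact quantileReal_nonneg F s
    simp only [intervalIntegral.integral_zero] at h2
    simp only [Set.mem_ofPred_eq] at hzs₀
    linarith
  have hle : ∀ t ∈ Set.Icc (0 : ℝ) 1, Φ (z t) ≤ quantileReal F t := fun t ht => by
    rw [← hl (quantileReal F t)]
    refine hmono.monotone ((?_ : z t ≤ ∫ s in (0 : ℝ)..t, quantileReal F s).trans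
      ((integral_quantileReal_le F ht).trans
        (intSurvival_le_truncSurvival (quantileReal_nonneg F t))))
    rw [hz t ht]
    exact intervalIntegral.integral_mono_on ht.1 (hint _ _)
      (intervalIntegrable_quantileReal F _ _) fun s _ => sub_le_self _ (le_max_left _ _)
  refine ⟨_, hQc, fun t ht => ?_⟩
  have hQ : max 0 (min 1 (Φ (z t))) = Φ (z t) := by
    rw [min_eq_right ((hle t ht).trans (quantileReal_le_one F t)), max_eq_right]
    rw [← hΦ0]
    exact hmono.monotone (hz0 t ht)
  refine ⟨le_max_left _ _, ?_, ?_⟩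
  · simpa only [hQ] using hle t ht
  · simp only [hQ, hr]
    exact hz t ht

/-- An a priori lower bound, uniform in the truncation, on solutions at small times. -/
theorem half_integral_le_truncated_solution {k : ℝ} (hk : k ≤ 1) {Q : ℝ → ℝ}
    (hQc : Continuous Q)
    (hQ : ∀ t ∈ Set.Icc (0 : ℝ) 1, 0 ≤ Q t ∧ Q t ≤ quantileReal F t ∧
      truncSurvival F k (Q t) = ∫ s in (0 : ℝ)..t, (quantileReal F s - Q s))
    {t : ℝ} (ht : t ∈ Set.Icc (0 : ℝ) (1 / 4)) :
    (∫ s in (0 : ℝ)..t, quantileReal F s) / 2 ≤ Q t := by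
  have hsplit : ∀ s, ∫ u in (0 : ℝ)..s, (quantileReal F u - Q u) =
      (∫ u in (0 : ℝ)..s, quantileReal F u) - ∫ u in (0 : ℝ)..s, Q u := fun s =>
    intervalIntegral.integral_sub (intervalIntegrable_quantileReal F _ _)
      (hQc.intervalIntegrable _ _)
  have hmem : ∀ s ∈ Set.Icc (0 : ℝ) t, s ∈ Set.Icc (0 : ℝ) 1 := fun s hs =>
    ⟨hs.1, by linarith [hs.2, ht.2]⟩
  have hup : ∀ s ∈ Set.Icc (0 : ℝ) t, Q s ≤ 4 / 3 * ∫ u in (0 : ℝ)..t, quantileReal F u := by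
    intro s hs
    obtain ⟨h1, h2, h3⟩ := hQ s (hmem s hs)
    -- Below `Q s ≤ F⁻(s)` the CDF is less than `s ≤ 1/4`, so the survival function exceeds `3/4`
    -- there.
    have h4 := mul_sub_le_truncSurvival_sub (F := F) (k := k) (C := 3 / 4) h1 fun x hx0 hx => by
      have hx1 : x ∈ Set.Icc (0 : ℝ) 1 := ⟨hx0.le, by linarith [quantileReal_le_one F s]⟩
      have : ¬ s ≤ cdfReal F x := by
        rw [← quantileReal_le_iff F (hmem s hs) hx1]
        linarith
      refine le_max_of_le_left ?_
      linarith [hs.2, ht.2]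
    have h5 : 0 ≤ ∫ u in (0 : ℝ)..s, Q u := intervalIntegral.integral_nonneg hs.1 fun u hu =>
      (hQ u (hmem u ⟨hu.1, hu.2.trans hs.2⟩)).1
    have h6 := integral_quantileReal_mono (F := F) hs.2
    rw [h3, hsplit, truncSurvival_zero] at h4
    linarith
  set A := ∫ u in (0 : ℝ)..t, quantileReal F u with hA
  have hA0 : 0 ≤ A := intervalIntegral.integral_nonneg ht.1 fun u _ => quantileReal_nonneg F u
  have hI : ∫ u in (0 : ℝ)..t, Q u ≤ t * (4 / 3 * A) := by
    calc _ ≤ ∫ u in (0 : ℝ)..t, 4 / 3 * A := intervalIntegral.integral_mono_on ht.1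
          (hQc.intervalIntegrable _ _) intervalIntegrable_const hup
      _ = _ := by simp; ring
  -- With `t ≤ 1/4` the bound above gives `∫ Q ≤ A / 3`, hence `Q t ≥ A - A / 3 ≥ A / 2`.
  obtain ⟨h1, -, h3⟩ := hQ t (hmem t ⟨ht.1, le_rfl⟩)
  have h4 := truncSurvival_le_self (F := F) hk h1
  rw [h3, hsplit] at h4
  nlinarith [ht.2]

/-- A real-variable solution of the integrated initial value problem, bounded away from the region
where the CDF equals `1`. -/
theorem exists_real_solution (h0 : cdf F 0 = 0) :
    ∃ (x₁ : ℝ) (Q : ℝ → ℝ), cdfReal F x₁ < 1 ∧ Continuous Q ∧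
      ∀ t ∈ Set.Icc (0 : ℝ) 1, 0 ≤ Q t ∧ Q t ≤ quantileReal F t ∧ Q t < x₁ ∧ (0 < t → 0 < Q t) ∧
        truncSurvival F (1 - cdfReal F x₁) (Q t) =
          ∫ s in (0 : ℝ)..t, (quantileReal F s - Q s) := by
  have hAc := continuous_integral_quantileReal F
  set A : ℝ → ℝ := fun t => ∫ s in (0 : ℝ)..t, quantileReal F s with hA
  set δ : ℝ := ∫ t in (0 : ℝ)..1 / 4, A t / 2 with hδ
  have hδ0 : 0 < δ := intervalIntegral.intervalIntegral_pos_of_pos_on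
    ((hAc.div_const 2).intervalIntegrable _ _)
    (fun t ht => half_pos (integral_quantileReal_pos h0 ⟨ht.1, by linarith [ht.2]⟩)) (by norm_num)
  set m := quantileReal F 1 with hm
  have hm0 : 0 < m := quantileReal_pos h0 ⟨zero_lt_one, le_rfl⟩
  have hm1 : m ≤ 1 := quantileReal_le_one F 1
  -- Since `x₁` lies below the top quantile `m`, `F(x₁) < 1`; since it is within `δ / 2` of `m`, `G`
  -- increases by at most `δ / 2` between them. As `δ` was fixed before the truncation level `k = 1
  -- - F(x₁)`, there is no circularity.
  set x₁ := max 0 (m - δ / 2) with hx₁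
  have hx₁m : x₁ < m := max_lt hm0 (by linarith)
  have hc : cdfReal F x₁ < 1 := by
    rw [← not_le, ← quantileReal_le_iff F ⟨zero_le_one, le_rfl⟩
      ⟨le_max_left _ _, hx₁m.le.trans hm1⟩]
    exact not_le.2 hx₁m
  have hk0 : 0 < 1 - cdfReal F x₁ := sub_pos.2 hc
  have hk1 : 1 - cdfReal F x₁ ≤ 1 := by linarith [cdfReal_nonneg F x₁]
  obtain ⟨Q, hQc, hQ⟩ := exists_truncated_solution F hk0
  have hhalf := fun t ht => half_integral_le_truncated_solution hk1 hQc hQ (t := t) ht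
  have hmono : ∀ s ∈ Set.Icc (0 : ℝ) 1, ∀ t ∈ Set.Icc (0 : ℝ) 1, s ≤ t → Q s ≤ Q t := by
    intro s hs t ht hst
    rw [← (strictMono_truncSurvival (F := F) hk0).le_iff_le, ← sub_nonneg, (hQ s hs).2.2,
      (hQ t ht).2.2, intervalIntegral.integral_interval_sub_left
        (intervalIntegrable_quantileReal_sub F hQc _ _)
        (intervalIntegrable_quantileReal_sub F hQc _ _)]
    exact intervalIntegral.integral_nonneg hst fun u hu =>
      sub_nonneg.2 (hQ u ⟨hs.1.trans hu.1, hu.2.trans ht.2⟩).2.1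
  have hone : (1 : ℝ) ∈ Set.Icc (0 : ℝ) 1 := ⟨zero_le_one, le_rfl⟩
  have hQint : δ ≤ ∫ t in (0 : ℝ)..1, Q t := by
    rw [← intervalIntegral.integral_add_adjacent_intervals (b := 1 / 4)
      (hQc.intervalIntegrable _ _) (hQc.intervalIntegrable _ _)]
    have h1 : δ ≤ ∫ t in (0 : ℝ)..1 / 4, Q t :=
      intervalIntegral.integral_mono_on (by norm_num)
        ((hAc.div_const 2).intervalIntegrable _ _) (hQc.intervalIntegrable _ _) hhalf
    have h2 : 0 ≤ ∫ t in (1 / 4 : ℝ)..1, Q t := intervalIntegral.integral_nonneg (by norm_num)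
      fun t ht => (hQ t ⟨by linarith [ht.1], ht.2⟩).1
    linarith
  -- Otherwise `G(x₁) ≤ ∫ F⁻ - ∫ Q ≤ G(m) - δ`, although `G(m) - G(x₁) ≤ δ / 2`.
  have hQ1 : Q 1 < x₁ := by
    by_contra hge
    have h1 := intSurvival_mono F (not_lt.1 hge)
    have h2 := intSurvival_le_truncSurvival (F := F) (k := 1 - cdfReal F x₁) (hQ 1 hone).1
    rw [(hQ 1 hone).2.2, intervalIntegral.integral_sub (intervalIntegrable_quantileReal F _ _)
      (hQc.intervalIntegrable _ _)] at h2
    have h3 := integral_quantileReal_le F hone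
    have h4 := intSurvival_sub_le F hx₁m.le
    have h5 : m - δ / 2 ≤ x₁ := le_max_right _ _
    linarith
  refine ⟨x₁, Q, hc, hQc, fun t ht => ⟨(hQ t ht).1, (hQ t ht).2.1,
    (hmono t ht 1 hone ht.2).trans_lt hQ1, fun ht0 => ?_, (hQ t ht).2.2⟩⟩
  have hs : min t (1 / 4) ∈ Set.Ioc (0 : ℝ) 1 :=
    ⟨lt_min ht0 (by norm_num), (min_le_left _ _).trans ht.2⟩
  calc 0 < A (min t (1 / 4)) / 2 := half_pos (integral_quantileReal_pos h0 hs)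
    _ ≤ Q (min t (1 / 4)) := hhalf _ ⟨hs.1.le, min_le_right _ _⟩
    _ ≤ Q t := hmono _ ⟨hs.1.le, hs.2⟩ t ht (min_le_left _ _)

theorem truncSurvival_eq_intSurvival {x₁ x : ℝ} (hx0 : 0 ≤ x) (hx : x ≤ x₁) :
    truncSurvival F (1 - cdfReal F x₁) x = intSurvival F x :=
  intervalIntegral.integral_congr fun t ht => by
    rw [Set.uIcc_of_le hx0] at ht
    exact max_eq_left (sub_le_sub_left (cdfReal_mono F (ht.2.trans hx)) _)

theorem exists_isSolution (h0 : cdf F 0 = 0) : ∃ Q : QuantileStrategy, IsSolution F Q := by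
  obtain ⟨x₁, Q, hc, hQc, hQ⟩ := exists_real_solution h0
  set k := 1 - cdfReal F x₁ with hk
  have hk0 : 0 < k := sub_pos.2 hc
  have hint := intervalIntegrable_quantileReal_sub F hQc
  have hlt : ∀ t ∈ Set.Ioc (0 : ℝ) 1, Q t < quantileReal F t := by
    intro t ht
    have ht' : t ∈ Set.Icc (0 : ℝ) 1 := ⟨ht.1.le, ht.2⟩
    obtain ⟨h1, h2, h3, h4, h5⟩ := hQ t ht'
    -- `G(Q t) = ∫₀ᵗ F⁻ - ∫₀ᵗ Q`, and the last integral is positive, so `G(Q t) < ∫₀ᵗ F⁻ ≤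
    -- G(F⁻(t))`.
    refine (intSurvival_mono F).reflect_lt ?_
    rw [← truncSurvival_eq_intSurvival h1 h3.le, h5,
      intervalIntegral.integral_sub (intervalIntegrable_quantileReal F _ _)
      (hQc.intervalIntegrable _ _)]
    have h6 : 0 < ∫ s in (0 : ℝ)..t, Q s := intervalIntegral.intervalIntegral_pos_of_pos_on
      (hQc.intervalIntegrable _ _)
      (fun s hs => (hQ s ⟨hs.1.le, hs.2.le.trans ht.2⟩).2.2.2.1 hs.1) ht.1
    linarith [integral_quantileReal_le F ht']
  have hdiff : ∀ s ∈ Set.Icc (0 : ℝ) 1, ∀ t ∈ Set.Icc (0 : ℝ) 1,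
      truncSurvival F k (Q t) - truncSurvival F k (Q s) =
        ∫ u in s..t, (quantileReal F u - Q u) := fun s hs t ht => by
    rw [(hQ s hs).2.2.2.2, (hQ t ht).2.2.2.2]
    exact intervalIntegral.integral_interval_sub_left (hint _ _) (hint _ _)
  have hstrict : ∀ s ∈ Set.Icc (0 : ℝ) 1, ∀ t ∈ Set.Icc (0 : ℝ) 1, s < t → Q s < Q t := by
    intro s hs t ht hst
    rw [← (strictMono_truncSurvival (F := F) hk0).lt_iff_lt, ← sub_pos, hdiff s hs t ht]
    exact intervalIntegral.intervalIntegral_pos_of_pos_on (hint _ _)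
      (fun u hu => sub_pos.2 (hlt u ⟨hs.1.trans_lt hu.1, hu.2.le.trans ht.2⟩)) hst
  have hstep : ∀ s ∈ Set.Icc (0 : ℝ) 1, ∀ t ∈ Set.Icc (0 : ℝ) 1, s ≤ t →
      Q t - Q s ≤ k⁻¹ * (t - s) := by
    intro s hs t ht hst
    have hle : Q s ≤ Q t := by
      rcases hst.eq_or_lt with rfl | h
      · exact le_rfl
      · exact (hstrict s hs t ht h).le
    have h1 := mul_sub_le_truncSurvival_sub (F := F) (k := k) (C := k) hle
      fun _ _ _ => le_max_right _ _
    rw [hdiff s hs t ht] at h1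
    have h2 : ∫ u in s..t, (quantileReal F u - Q u) ≤ ∫ u in s..t, (1 : ℝ) :=
      intervalIntegral.integral_mono_on hst (hint _ _) intervalIntegrable_const fun u hu => by
        linarith [quantileReal_le_one F u, (hQ u ⟨hs.1.trans hu.1, hu.2.trans ht.2⟩).1]
    simp only [intervalIntegral.integral_const, smul_eq_mul, mul_one] at h2
    rw [le_inv_mul_iff₀ hk0]
    linarith
  have hLip : LipschitzOnWith (Real.toNNReal k⁻¹) Q (Set.Icc 0 1) := by
    refine LipschitzOnWith.of_dist_le_mul fun s hs t ht => ?_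
    rw [Real.coe_toNNReal _ (inv_pos.2 hk0).le, Real.dist_eq, Real.dist_eq]
    rcases le_total s t with h | h
    · rw [abs_sub_comm, abs_sub_comm s, abs_of_nonneg (sub_nonneg.2 h)]
      refine abs_le.2 ⟨?_, hstep s hs t ht h⟩
      have : Q s ≤ Q t := by
        rcases h.eq_or_lt with rfl | h
        · exact le_rfl
        · exact (hstrict s hs t ht h).le
      have : 0 ≤ k⁻¹ * (t - s) := mul_nonneg (inv_pos.2 hk0).le (sub_nonneg.2 h)
      linarith
    · rw [abs_of_nonneg (sub_nonneg.2 h)]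
      refine abs_le.2 ⟨?_, hstep t ht s hs h⟩
      have : Q t ≤ Q s := by
        rcases h.eq_or_lt with rfl | h
        · exact le_rfl
        · exact (hstrict t ht s hs h).le
      have : 0 ≤ k⁻¹ * (s - t) := mul_nonneg (inv_pos.2 hk0).le (sub_nonneg.2 h)
      linarith
  let q : I → I := fun y => ⟨Q y, (hQ y y.2).1,
    (hQ y y.2).2.1.trans (quantileReal_le_one F y)⟩
  have hqs : StrictMono q := fun s t hst => hstrict s s.2 t t.2 hst
  have hext : ∀ t ∈ Set.Icc (0 : ℝ) 1, extend q t = Q t := fun t ht => by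
    rw [extend, Set.IccExtend_of_mem _ _ ht]
  have hAC : AbsolutelyContinuousOnInterval (extend q) 0 1 := by
    refine LipschitzOnWith.absolutelyContinuousOnInterval (K := Real.toNNReal k⁻¹) ?_
    rw [Set.uIcc_of_le zero_le_one]
    intro s hs t ht
    rw [hext s hs, hext t ht]
    exact hLip hs ht
  obtain ⟨Φ, hΦ, -, hl, hr⟩ := exists_inverse_truncSurvival (F := F) hk0
  refine ⟨⟨q, hqs, hAC⟩, ?_, ?_, ?_, ?_⟩
  · have hb1 : ∀ᵐ y : I, y ≠ 0 := by simp [ae_iff]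
    have hb2 : ∀ᵐ y : I, y ≠ 1 := by simp [ae_iff]
    have hb3 := ((quantileReal_mono F).countable_not_continuousAt.preimage
      Subtype.val_injective (α := I)).ae_notMem volume
    -- The CDF has countably many discontinuities and `Q` is injective, so the CDF is continuous at
    -- `Q y` for almost every `y`.
    have hb4 := ((cdfReal_mono F).countable_not_continuousAt.preimage
      (f := fun y : I => Q y) fun a b hab => hqs.injective (Subtype.ext hab)).ae_notMem volume
    filter_upwards [hb1, hb2, hb3, hb4] with y hy0 hy1 hy3 hy4
    simp only [Set.mem_preimage, Set.mem_ofPred_eq, not_not] at hy3 hy4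
    have hy : (y : ℝ) ∈ Set.Ioo (0 : ℝ) 1 :=
      ⟨unitInterval.pos_iff_ne_zero.2 hy0, unitInterval.lt_one_iff_ne_one.2 hy1⟩
    obtain ⟨h1, -, h3, -, h5⟩ := hQ y y.2
    have dZ : HasDerivAt (fun t => ∫ s in (0 : ℝ)..t, (quantileReal F s - Q s))
        (quantileReal F y - Q y) (y : ℝ) :=
      intervalIntegral.integral_hasDerivAt_right (hint _ _)
        ((quantileReal_mono F).measurable.sub
          hQc.measurable).stronglyMeasurable.stronglyMeasurableAtFilter
        (hy3.sub hQc.continuousAt)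
    have dG : HasDerivAt (truncSurvival F k) (1 - cdfReal F (Q y)) (Q y) := by
      have : HasDerivAt (truncSurvival F k) (max (1 - cdfReal F (Q y)) k) (Q y) :=
        intervalIntegral.integral_hasDerivAt_right (antitone_max_survival F k).intervalIntegrable
          (antitone_max_survival F k).measurable.stronglyMeasurable.stronglyMeasurableAtFilter
          ((continuousAt_const.sub hy4).max continuousAt_const)
      rwa [max_eq_left (sub_le_sub_left (cdfReal_mono F h3.le) _)] at this
    have hne : 1 - cdfReal F (Q y) ≠ 0 := by
      have := cdfReal_mono F h3.le
      linarith
    have hΦQ : Φ (∫ s in (0 : ℝ)..y, (quantileReal F s - Q s)) = Q y := by rw [← h5, hl]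
    have dΦ : HasDerivAt Φ (1 - cdfReal F (Q y))⁻¹
        (∫ s in (0 : ℝ)..y, (quantileReal F s - Q s)) :=
      HasDerivAt.of_local_left_inverse hΦ.continuous.continuousAt (by rwa [hΦQ]) hne
        (Filter.Eventually.of_forall hr)
    have := dΦ.comp (y : ℝ) dZ
    have hval : ((quantile F y : ℝ) - q y) / (1 - cdf F (q y)) =
        (1 - cdfReal F (Q y))⁻¹ * (quantileReal F y - Q y) := by
      rw [quantileReal_coe, ← cdfReal_coe F (q y), div_eq_inv_mul]
    change HasDerivAt (extend q) (((quantile F y : ℝ) - q y) / (1 - cdf F (q y))) y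
    rw [hval]
    refine this.congr_of_eventuallyEq ?_
    filter_upwards [Icc_mem_nhds hy.1 hy.2] with t ht
    rw [hext t ht, Function.comp_apply, ← (hQ t ht).2.2.2.2, hl]
  · have h5 := (hQ 0 ⟨le_rfl, zero_le_one⟩).2.2.2.2
    rw [intervalIntegral.integral_same] at h5
    exact Subtype.ext ((strictMono_truncSurvival (F := F) hk0).injective
      (h5.trans (truncSurvival_zero F k).symm))
  · exact fun y hy => (hQ y y.2).2.2.2.1 hy
  · intro y hy
    have := hlt y ⟨hy, y.2.2⟩
    rw [quantileReal_coe] at this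
    exact this

end

/-! ### Regret against deterministic competing bids -/

section

instance (s : Strategy) : IsMarkovKernel s.1 := s.2

theorem measurable_utility : Measurable fun p : I × I × I => utility p.1 p.2.1 p.2.2 := by
  refine Measurable.ite (measurableSet_le measurable_snd.fst measurable_fst) ?_ measurable_const
  exact (measurable_subtype_coe.comp measurable_snd.snd).sub
    (measurable_subtype_coe.comp measurable_fst)

theorem abs_utility_le (b h v : I) : |utility b h v| ≤ 1 := by
  unfold utility
  split_ifs
  · exact abs_le.2 ⟨by linarith [b.2.2, v.2.1], by linarith [b.2.1, v.2.2]⟩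
  · simp

theorem utility_le_max (b h v : I) : utility b h v ≤ max ((v : ℝ) - h) 0 := by
  unfold utility
  split_ifs with hb
  · exact le_max_of_le_left (sub_le_sub_left (Subtype.coe_le_coe.2 hb) _)
  · exact le_max_right _ _

theorem integrable_of_abs_le_one {α : Type*} [MeasurableSpace α] {μ : Measure α}
    [IsFiniteMeasure μ] {f : α → ℝ} (hf : Measurable f) (hb : ∀ x, |f x| ≤ 1) :
    Integrable f μ :=
  Integrable.of_bound hf.aestronglyMeasurable 1 (Filter.Eventually.of_forall hb)

theorem abs_integral_le_one {α : Type*} [MeasurableSpace α] {μ : Measure α}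
    [IsProbabilityMeasure μ] {f : α → ℝ} (hb : ∀ x, |f x| ≤ 1) : |∫ x, f x ∂μ| ≤ 1 := by
  have := norm_integral_le_of_norm_le_const (μ := μ) (f := f) (C := 1)
    (Filter.Eventually.of_forall hb)
  simpa using this

/-- The expected utility of value `v` against the fixed competing bid `h`. -/
def valueUtility (s : Strategy) (v h : I) : ℝ := ∫ b, utility b h v ∂(s.1 v)

/-- The expected utility against the fixed competing bid `h`. -/
def pointUtility (F : ProbabilityMeasure I) (s : Strategy) (h : I) : ℝ :=
  ∫ v, valueUtility s v h ∂(F : Measure I)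

/-- The expected utility of the best response to the fixed competing bid `h`. -/
def surplus (F : ProbabilityMeasure I) (h : I) : ℝ := ∫ v : I, max ((v : ℝ) - h) 0 ∂(F : Measure I)

theorem measurable_valueUtility (s : Strategy) :
    Measurable fun p : I × I => valueUtility s p.1 p.2 := by
  have h := StronglyMeasurable.integral_kernel_prod_right' (κ := s.1.comap Prod.fst measurable_fst)
    (f := fun x : (I × I) × I => utility x.2 x.1.2 x.1.1)
    (measurable_utility.comp (measurable_snd.prodMk
      (measurable_fst.snd.prodMk measurable_fst.fst))).stronglyMeasurable
  exact h.measurable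

theorem abs_valueUtility_le (s : Strategy) (v h : I) : |valueUtility s v h| ≤ 1 :=
  abs_integral_le_one fun b => abs_utility_le b h v

theorem integrable_utility (μ : Measure I) [IsFiniteMeasure μ] (h v : I) :
    Integrable (fun b => utility b h v) μ :=
  integrable_of_abs_le_one
    (measurable_utility.comp (measurable_id.prodMk (measurable_const (a := (h, v)))))
    fun b => abs_utility_le b h v

theorem valueUtility_le_max (s : Strategy) (v h : I) :
    valueUtility s v h ≤ max ((v : ℝ) - h) 0 := by
  have := integral_mono (integrable_utility (s.1 v) h v) (integrable_const (max ((v : ℝ) - h) 0))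
    fun b => utility_le_max b h v
  rwa [integral_const, probReal_univ, one_smul] at this

variable (F : ProbabilityMeasure I)

theorem integrable_valueUtility (s : Strategy) (h : I) :
    Integrable (fun v => valueUtility s v h) (F : Measure I) :=
  integrable_of_abs_le_one ((measurable_valueUtility s).comp
    (measurable_id.prodMk measurable_const)) fun v => abs_valueUtility_le s v h

theorem measurable_max_sub (h : I) : Measurable fun v : I => max ((v : ℝ) - h) 0 :=
  (measurable_subtype_coe.sub measurable_const).max measurable_const

theorem integrable_max_sub (h : I) :
    Integrable (fun v : I => max ((v : ℝ) - h) 0) (F : Measure I) :=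
  integrable_of_abs_le_one (measurable_max_sub h) fun v => by
    rw [abs_of_nonneg (le_max_right _ _)]
    exact max_le (by linarith [v.2.2, h.2.1]) zero_le_one

theorem measurable_pointUtility (s : Strategy) : Measurable (pointUtility F s) :=
  ((measurable_valueUtility s).stronglyMeasurable.integral_prod_left'
    (μ := (F : Measure I))).measurable

theorem abs_pointUtility_le (s : Strategy) (h : I) : |pointUtility F s h| ≤ 1 :=
  abs_integral_le_one fun v => abs_valueUtility_le s v h

theorem pointUtility_le_surplus (s : Strategy) (h : I) : pointUtility F s h ≤ surplus F h :=
  integral_mono (integrable_valueUtility F s h) (integrable_max_sub F h)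
    fun v => valueUtility_le_max s v h

theorem expUtility_eq_integral (s : Strategy) (H : ProbabilityMeasure I) :
    expUtility F s H = ∫ h, pointUtility F s h ∂(H : Measure I) :=
  integral_prod_symm _ (integrable_of_abs_le_one (measurable_valueUtility s)
    fun p => abs_valueUtility_le s p.1 p.2)

theorem integrable_pointUtility (s : Strategy) (μ : Measure I) [IsFiniteMeasure μ] :
    Integrable (pointUtility F s) μ :=
  integrable_of_abs_le_one (measurable_pointUtility F s) (abs_pointUtility_le F s)

theorem abs_expUtility_le (s : Strategy) (H : ProbabilityMeasure I) : |expUtility F s H| ≤ 1 := by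
  rw [expUtility_eq_integral]
  exact abs_integral_le_one (abs_pointUtility_le F s)

theorem bddAbove_expUtility (H : ProbabilityMeasure I) :
    BddAbove (Set.range fun s : Strategy => expUtility F s H) :=
  ⟨1, by rintro _ ⟨s, rfl⟩; exact (abs_le.1 (abs_expUtility_le F s H)).2⟩

instance : Nonempty Strategy := ⟨⟨Kernel.const I (Measure.dirac 0), inferInstance⟩⟩

theorem bddAbove_regret (s : Strategy) :
    BddAbove (Set.range fun H : ProbabilityMeasure I => regret F s H) := by
  refine ⟨2, ?_⟩
  rintro _ ⟨H, rfl⟩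
  have h1 : (⨆ s' : Strategy, expUtility F s' H) ≤ 1 :=
    ciSup_le fun s' => (abs_le.1 (abs_expUtility_le F s' H)).2
  have h2 := (abs_le.1 (abs_expUtility_le F s H)).1
  simp only [regret]
  linarith

/-- The best response to the competing bid `h`. -/
theorem exists_pointUtility_eq_surplus (h : I) :
    ∃ s : Strategy, pointUtility F s h = surplus F h := by
  -- Match the competing bid if it is at most the value; otherwise `h > v ≥ 0`, so the bid `0`
  -- loses.
  have hm : Measurable fun v : I => if h ≤ v then h else 0 :=
    Measurable.ite (measurableSet_le measurable_const measurable_id) measurable_const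
      measurable_const
  refine ⟨⟨Kernel.deterministic _ hm, inferInstance⟩, ?_⟩
  refine integral_congr_ae (Filter.Eventually.of_forall fun v => ?_)
  simp only [valueUtility, Kernel.deterministic_apply, integral_dirac, utility]
  by_cases hv : h ≤ v
  · have : (h : ℝ) ≤ v := hv
    simp [hv, this]
  · have h1 : (v : ℝ) ≤ h := (not_le.1 hv).le
    have h2 : ¬ h ≤ 0 := fun h0 => hv (h0.trans unitInterval.nonneg')
    simp [hv, h2, h1]

/-- Test the worst case on the point mass at `h`. -/
theorem surplus_sub_le_worstRegret (s : Strategy) (h : I) :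
    surplus F h - pointUtility F s h ≤ worstRegret F s := by
  set H : ProbabilityMeasure I := ⟨Measure.dirac h, inferInstance⟩ with hH
  have hU : ∀ s' : Strategy, expUtility F s' H = pointUtility F s' h := fun s' => by
    rw [expUtility_eq_integral]
    exact integral_dirac _ _
  obtain ⟨s', hs'⟩ := exists_pointUtility_eq_surplus F h
  have h1 := le_ciSup (bddAbove_expUtility F H) s'
  have h2 := le_ciSup (bddAbove_regret F s) H
  simp only [hU, hs'] at h1
  simp only [regret, hU] at h2
  refine le_trans ?_ h2
  linarith

/-- Even a buyer who knew `h` could earn no more than the surplus, so the regret against `H` is at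
most an `H`-average of the bounds at fixed `h`. -/
theorem worstRegret_le {s : Strategy} {R : ℝ}
    (hR : ∀ h, surplus F h - pointUtility F s h ≤ R) : worstRegret F s ≤ R := by
  have : Nonempty (ProbabilityMeasure I) := ⟨F⟩
  refine ciSup_le fun H => ?_
  have h1 : (⨆ s' : Strategy, expUtility F s' H) ≤ R + expUtility F s H := by
    refine ciSup_le fun s' => ?_
    have hi := integrable_pointUtility F s (H : Measure I)
    rw [expUtility_eq_integral, expUtility_eq_integral]
    have h2 := integral_mono (integrable_pointUtility F s' (H : Measure I))
      ((integrable_const R).add hi) fun h => by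
        have := pointUtility_le_surplus F s' h
        have := hR h
        simp only [Pi.add_apply]
        linarith
    rw [integral_add' (integrable_const R) hi] at h2
    simpa using h2
  simp only [regret]
  linarith

/-! ### Splitting off the atom at value zero -/

variable {F}

theorem integral_eq_of_condPos {Ft : ProbabilityMeasure I} (h : (Ft : Measure I).real {0} < 1)
    {f : I → ℝ} (hf : Measurable f) (hb : ∀ x, |f x| ≤ 1) :
    ∫ v, f v ∂(Ft : Measure I) = (Ft : Measure I).real {0} * f 0 +
      (1 - (Ft : Measure I).real {0}) * ∫ v, f v ∂(condPos Ft h : Measure I) := by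
  have h1 := probReal_compl_eq_one_sub (μ := (Ft : Measure I)) (measurableSet_singleton 0)
  have h2 : ∫ v, f v ∂(condPos Ft h : Measure I) =
      ((Ft : Measure I).real {0}ᶜ)⁻¹ * ∫ v in ({0}ᶜ : Set I), f v ∂(Ft : Measure I) := by
    change ∫ v, f v ∂((Ft : Measure I)[|{0}ᶜ]) = _
    rw [ProbabilityTheory.cond, integral_smul_measure, ENNReal.toReal_inv]
    rfl
  have hne : 1 - (Ft : Measure I).real {0} ≠ 0 := by linarith
  rw [h2, h1, mul_inv_cancel_left₀ hne,
    ← integral_add_compl (measurableSet_singleton (0 : I)) (integrable_of_abs_le_one hf hb),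
    integral_singleton]
  rfl

theorem cdf_condPos_zero {Ft : ProbabilityMeasure I} (h : (Ft : Measure I).real {0} < 1) :
    cdf (condPos Ft h) 0 = 0 := by
  have h1 : Set.Iic (0 : I) = {0} := by
    ext x
    simp only [Set.mem_Iic, Set.mem_singleton_iff]
    exact ⟨fun hx => le_antisymm hx unitInterval.nonneg', fun hx => hx.le⟩
  change ((Ft : Measure I)[|{0}ᶜ]).real (Set.Iic (0 : I)) = 0
  rw [h1, measureReal_def, cond_apply (measurableSet_singleton 0).compl]
  simp

variable {Ft : ProbabilityMeasure I} (h : (Ft : Measure I).real {0} < 1)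

theorem surplus_eq_of_condPos (p : I) :
    surplus Ft p = (1 - (Ft : Measure I).real {0}) * surplus (condPos Ft h) p := by
  have h0 : max (((0 : I) : ℝ) - p) 0 = 0 := max_eq_right (by simp [p.2.1])
  rw [surplus, integral_eq_of_condPos h (measurable_max_sub p), h0, mul_zero, zero_add, surplus]
  intro v
  rw [abs_of_nonneg (le_max_right _ _)]
  exact max_le (by linarith [v.2.2, p.2.1]) zero_le_one

theorem pointUtility_eq_of_condPos (s : Strategy) (p : I) :
    pointUtility Ft s p = (Ft : Measure I).real {0} * valueUtility s 0 p +
      (1 - (Ft : Measure I).real {0}) * pointUtility (condPos Ft h) s p :=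
  integral_eq_of_condPos h ((measurable_valueUtility s).comp
    (measurable_id.prodMk measurable_const)) fun v => abs_valueUtility_le s v p

/-- Value `0` contributes nothing to the surplus and a nonpositive amount to the utility, so the
atom can only increase regret. -/
theorem mul_worstRegret_condPos_le (s : Strategy) :
    (1 - (Ft : Measure I).real {0}) * worstRegret (condPos Ft h) s ≤ worstRegret Ft s := by
  have ha : 0 < 1 - (Ft : Measure I).real {0} := sub_pos.2 h
  rw [← le_div_iff₀' ha]
  refine worstRegret_le _ fun p => ?_
  rw [le_div_iff₀' ha]
  have h1 := surplus_sub_le_worstRegret Ft s p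
  rw [surplus_eq_of_condPos h, pointUtility_eq_of_condPos h] at h1
  have h2 : valueUtility s 0 p ≤ 0 := by
    refine (valueUtility_le_max s 0 p).trans (max_le ?_ le_rfl)
    simp [p.2.1]
  have h3 : (Ft : Measure I).real {0} * valueUtility s 0 p ≤ 0 :=
    mul_nonpos_of_nonneg_of_nonpos measureReal_nonneg h2
  linarith

theorem ae_ne_zero_condPos : ∀ᵐ v ∂(condPos Ft h : Measure I), v ≠ 0 := by
  change ∀ᵐ v ∂((Ft : Measure I)[|{0}ᶜ]), v ≠ 0
  exact ae_cond_mem (measurableSet_singleton (0 : I)).compl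

/-- Bidding `0` at value `0` makes the contribution of the atom vanish exactly. -/
theorem worstRegret_bidZeroAtZero_le (s : Strategy) :
    worstRegret Ft (bidZeroAtZero s) ≤
      (1 - (Ft : Measure I).real {0}) * worstRegret (condPos Ft h) s := by
  have ha : 0 < 1 - (Ft : Measure I).real {0} := sub_pos.2 h
  refine worstRegret_le _ fun p => ?_
  have h0 : valueUtility (bidZeroAtZero s) 0 p = 0 := by
    simp [valueUtility, bidZeroAtZero, Kernel.piecewise_apply, utility]
  have h1 : pointUtility (condPos Ft h) (bidZeroAtZero s) p = pointUtility (condPos Ft h) s p := by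
    refine integral_congr_ae ?_
    filter_upwards [ae_ne_zero_condPos h] with v hv
    simp [valueUtility, bidZeroAtZero, Kernel.piecewise_apply, hv]
  rw [surplus_eq_of_condPos h, pointUtility_eq_of_condPos h, h0, h1, mul_zero, zero_add, ← mul_sub]
  exact mul_le_mul_of_nonneg_left (surplus_sub_le_worstRegret _ s p) ha.le

end

/-! ### The upper bound: a solution equalizes regret -/

section

/-- `F⁻` is constant on `[y, F(F⁻(y))]`; if its level set is null, this interval is a single point.
-/
theorem cdf_quantile_of_volume_quantileSet_eq_zero (F : ProbabilityMeasure I) {y : I}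
    (hy : volume (quantileSet F (quantile F y)) = 0) :
    (⟨cdf F (quantile F y), cdf_mem F _⟩ : I) = y := by
  set z : I := ⟨cdf F (quantile F y), cdf_mem F _⟩ with hz
  have hyz : y ≤ z := le_cdf_quantile F y
  have hsub : Set.Icc y z ⊆ quantileSet F (quantile F y) := fun t ht =>
    le_antisymm ((quantile_le_iff F t _).2 ht.2) (quantile_mono F ht.1)
  have h0 := measure_mono_null hsub hy
  rw [unitInterval.volume_Icc, ENNReal.ofReal_eq_zero, sub_nonpos] at h0
  exact le_antisymm h0 hyz

/-- Under `F` and `s_Q`, value and bid are jointly distributed as `F⁻(y)` and `Q(y)` for uniform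
`y`. -/
theorem integral_bidLaw (F : ProbabilityMeasure I) (Q : QuantileStrategy) {φ : I × I → ℝ}
    (hφ : Measurable φ) (hb : ∀ p, |φ p| ≤ 1) :
    ∫ v, ∫ b, φ (v, b) ∂(bidLaw F Q v) ∂(F : Measure I) = ∫ y : I, φ (quantile F y, Q y) := by
  have hprob := isProbabilityMeasure_bidLaw F Q
  set ψ : I → ℝ := fun v => ∫ b, φ (v, b) ∂(bidLaw F Q v) with hψ
  have hψm : Measurable ψ := (StronglyMeasurable.integral_kernel_prod_right'
    (κ := (quantileBidding F Q).1) hφ.stronglyMeasurable).measurable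
  have hψb : ∀ v, |ψ v| ≤ 1 := fun v => abs_integral_le_one fun b => hb _
  have hqm := (quantile_mono F).measurable
  have hi1 : Integrable fun y : I => ψ (quantile F y) :=
    integrable_of_abs_le_one (hψm.comp hqm) fun y => hψb _
  have hφm : Measurable fun y : I => φ (quantile F y, Q y) := hφ.comp (hqm.prodMk Q.measurable)
  have hi2 : Integrable fun y : I => φ (quantile F y, Q y) :=
    integrable_of_abs_le_one hφm fun y => hb _
  rw [integral_eq_integral_quantile F hψm, ← sub_eq_zero, ← integral_sub hi1 hi2]
  -- `C` is the set of atoms. Over an atom `v`, `bidLaw` averages over `Y(v)`, so the integrals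
  -- agree on each of these countably many level sets; off them `F(F⁻(y)) = y` and the integrands
  -- agree pointwise.
  set C : Set I := {v | volume (quantileSet F v) ≠ 0} with hC
  have hCc : C.Countable := countable_quantileSet_pos F
  have : Countable C := hCc.to_subtype
  have hN : quantile F ⁻¹' C = ⋃ v : C, quantileSet F v := by
    ext y
    simp only [Set.mem_preimage, Set.mem_iUnion]
    refine ⟨fun hy => ⟨⟨_, hy⟩, rfl⟩, fun ⟨v, hv⟩ => ?_⟩
    have hv : quantile F y = v := hv
    exact hv ▸ v.2
  have hi : Integrable fun y : I => ψ (quantile F y) - φ (quantile F y, Q y) := hi1.sub hi2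
  rw [← integral_add_compl (hqm hCc.measurableSet) hi]
  have hz1 : ∫ y in quantile F ⁻¹' C, (ψ (quantile F y) - φ (quantile F y, Q y)) = 0 := by
    rw [hN, integral_iUnion (s := fun v : C => quantileSet F v) (fun v => measurableSet_quantileSet F v) (fun v w hvw =>
      Set.disjoint_left.2 fun y hy hy' => hvw (Subtype.ext (hy.symm.trans hy')))
      hi.integrableOn]
    refine (tsum_congr fun v => ?_).trans tsum_zero
    have hv : volume (quantileSet F v) ≠ 0 := v.2
    have e1 : ∫ y in quantileSet F v, (ψ (quantile F y) - φ (quantile F y, Q y)) =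
        ∫ y in quantileSet F v, (ψ v - φ (v, Q y)) :=
      setIntegral_congr_fun (measurableSet_quantileSet F v) fun y hy => by
        have hy : quantile F y = v := hy
        simp only [hy]
    have hi3 : Integrable fun y : I => φ (v, Q y) :=
      integrable_of_abs_le_one (hφ.comp (measurable_const.prodMk Q.measurable)) fun y => hb _
    have e2 : ψ v = (volume (quantileSet F v)).toReal⁻¹ * ∫ y in quantileSet F v, φ (v, Q y) := by
      have hφv : Measurable fun b => φ (v, b) := hφ.comp (measurable_const.prodMk measurable_id)
      simp only [hψ, bidLaw, if_neg hv]
      rw [integral_map Q.measurable.aemeasurable hφv.aestronglyMeasurable,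
        ProbabilityTheory.cond, integral_smul_measure, ENNReal.toReal_inv]
      rfl
    have hne : (volume (quantileSet F v)).toReal ≠ 0 :=
      ENNReal.toReal_ne_zero.2 ⟨hv, measure_ne_top _ _⟩
    rw [e1, integral_sub (integrable_const _) hi3.integrableOn, setIntegral_const, smul_eq_mul, e2,
      measureReal_def, mul_inv_cancel_left₀ hne, sub_self]
  have hz2 : ∫ y in (quantile F ⁻¹' C)ᶜ, (ψ (quantile F y) - φ (quantile F y, Q y)) = 0 := by
    rw [setIntegral_congr_fun (g := fun _ => (0 : ℝ)) (hqm hCc.measurableSet).compl]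
    · simp
    · intro y hy
      have hy : volume (quantileSet F (quantile F y)) = 0 := not_not.1 hy
      simp only [hψ, bidLaw, if_pos hy, integral_dirac,
        cdf_quantile_of_volume_quantileSet_eq_zero F hy, sub_self]
  rw [hz1, hz2, add_zero]

theorem pointUtility_quantileBidding (F : ProbabilityMeasure I) (Q : QuantileStrategy) (h : I) :
    pointUtility F (quantileBidding F Q) h = ∫ y : I, utility (Q y) h (quantile F y) :=
  integral_bidLaw F Q (φ := fun p => utility p.2 h p.1)
    (measurable_utility.comp (measurable_snd.prodMk (measurable_const.prodMk measurable_fst)))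
    fun p => abs_utility_le p.2 h p.1

theorem surplus_eq_intSurvival (F : ProbabilityMeasure I) (h : I) :
    surplus F h = intSurvival F 1 - intSurvival F h := by
  rw [surplus, integral_eq_integral_quantile F (measurable_max_sub h),
    ← integral_max_quantileReal_sub F h.2, ← integral_coe_eq_intervalIntegral]
  simp only [quantileReal_coe]

/-- Lipschitz maps preserve absolute continuity. -/
theorem absolutelyContinuousOnInterval_comp_of_lipschitzOnWith {f g : ℝ → ℝ} {a b : ℝ}
    {K : NNReal} {s : Set ℝ} (hf : LipschitzOnWith K f s)
    (hg : AbsolutelyContinuousOnInterval g a b) (hs : Set.MapsTo g (Set.uIcc a b) s) :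
    AbsolutelyContinuousOnInterval (f ∘ g) a b := by
  unfold AbsolutelyContinuousOnInterval at hg ⊢
  have hlim := hg.const_mul (K : ℝ)
  rw [mul_zero] at hlim
  refine squeeze_zero' (Filter.Eventually.of_forall fun E =>
    Finset.sum_nonneg fun i _ => dist_nonneg) ?_ hlim
  filter_upwards [Filter.mem_inf_of_right (Filter.mem_principal_self _)] with E hE
  rw [Finset.mul_sum]
  exact Finset.sum_le_sum fun i hi =>
    hf.dist_le_mul _ (hs (hE.1 i hi).1) _ (hs (hE.1 i hi).2)

theorem eq_add_integral_of_absolutelyContinuousOnInterval {f f' : ℝ → ℝ}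
    (hf : AbsolutelyContinuousOnInterval f 0 1)
    (hd : ∀ᵐ t : ℝ, t ∈ Set.Icc (0 : ℝ) 1 → HasDerivAt f (f' t) t) {a b : ℝ}
    (ha : a ∈ Set.Icc (0 : ℝ) 1) (hb : b ∈ Set.Icc (0 : ℝ) 1) :
    ∫ t in a..b, f' t = f b - f a := by
  have hsub : Set.uIcc a b ⊆ Set.Icc 0 1 := Set.uIcc_subset_Icc ha hb
  rw [← (hf.mono (by rwa [Set.uIcc_of_le (zero_le_one' ℝ)])).integral_deriv_eq_sub]
  refine intervalIntegral.integral_congr_ae ?_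
  filter_upwards [hd] with t ht htab
  exact (ht (hsub (Set.uIoc_subset_uIcc htab))).deriv.symm

namespace QuantileStrategy

variable (Q : QuantileStrategy)

theorem extend_coe (y : I) : extend Q y = Q y := by
  simp [extend]

theorem continuous : Continuous Q := by
  have h := Q.absolutelyContinuous.continuousOn
  rw [Set.uIcc_of_le zero_le_one] at h
  refine continuous_induced_rng.2 ?_
  have := continuousOn_iff_continuous_domRestrict.1 h
  convert this using 1
  ext y
  exact (extend_coe Q y).symm

theorem continuous_extend : Continuous (extend Q) :=
  (continuous_subtype_val.comp Q.continuous).Icc_extend'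

theorem extend_mono : Monotone (extend Q) := fun _ _ h =>
  Q.strictMono.monotone (Set.monotone_projIcc _ h)

theorem extend_le_coe_one (t : ℝ) : extend Q t ≤ Q 1 :=
  Q.strictMono.monotone unitInterval.le_one'

end QuantileStrategy

variable {F : ProbabilityMeasure I} {Q : QuantileStrategy}

theorem ae_hasDerivAt_extend (hQ : IsSolution F Q) :
    ∀ᵐ t : ℝ, t ∈ Set.Icc (0 : ℝ) 1 → ContinuousAt (cdfReal F) (extend Q t) ∧
      HasDerivAt (extend Q) ((quantileReal F t - extend Q t) / (1 - cdfReal F (extend Q t))) t := by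
  rw [← ae_coe_iff]
  have hb := ((cdfReal_mono F).countable_not_continuousAt.preimage
    (f := fun y : I => (Q y : ℝ)) fun a b hab =>
      Q.strictMono.injective (Subtype.ext hab)).ae_notMem volume
  filter_upwards [hQ.ode, hb] with y hy hyb
  simp only [Set.mem_preimage, Set.mem_ofPred_eq, not_not] at hyb
  rw [Q.extend_coe, quantileReal_coe, cdfReal_coe]
  exact ⟨hyb, hy⟩

theorem cdf_bid_one_lt_one (hQ : IsSolution F Q) : cdf F (Q 1) < 1 := by
  have := hQ.lt_quantile 1 zero_lt_one
  rw [← not_le, quantile_le_iff] at this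
  simpa using this

theorem cdfReal_extend_le (t : ℝ) : cdfReal F (extend Q t) ≤ cdf F (Q 1) := by
  rw [← cdfReal_coe]
  exact cdfReal_mono F (Q.extend_le_coe_one t)

theorem one_sub_cdfReal_extend_pos (hQ : IsSolution F Q) (t : ℝ) :
    0 < 1 - cdfReal F (extend Q t) := by
  linarith [cdf_bid_one_lt_one hQ, cdfReal_extend_le (F := F) (Q := Q) t]

/-- The chain rule cancels the denominator of the differential equation: `(G ∘ Q)' = (1 - F(Q)) Q' =
F⁻ - Q` almost everywhere. Absolute continuity of `Q`, preserved by the Lipschitz map `G`, permits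
integration. -/
theorem intSurvival_bid (hQ : IsSolution F Q) (x : I) :
    intSurvival F (Q x) = ∫ t in (0 : ℝ)..x, (quantileReal F t - extend Q t) := by
  have hAC := absolutelyContinuousOnInterval_comp_of_lipschitzOnWith
    (lipschitzWith_intSurvival F).lipschitzOnWith Q.absolutelyContinuous
    (Set.mapsTo_univ _ _)
  rw [eq_add_integral_of_absolutelyContinuousOnInterval hAC (f' := fun t =>
    quantileReal F t - extend Q t) ?_ ⟨le_rfl, zero_le_one⟩ x.2]
  · have h0 : extend Q 0 = 0 := by
      have := Q.extend_coe 0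
      rwa [hQ.zero] at this
    simp only [Function.comp_apply]
    rw [Q.extend_coe, h0, intSurvival_zero, sub_zero]
  · filter_upwards [ae_hasDerivAt_extend hQ] with t ht htI
    obtain ⟨h1, h2⟩ := ht htI
    have := (hasDerivAt_intSurvival F h1).comp t h2
    rwa [mul_div_cancel₀ _ (one_sub_cdfReal_extend_pos hQ t).ne'] at this

theorem integral_ite_le (x : I) (f : ℝ → ℝ) :
    ∫ y : I, (if x ≤ y then f y else 0) = ∫ t in (x : ℝ)..1, f t := by
  have h1 : ∀ y : I, (if x ≤ y then f y else 0) = (Set.Ici (x : ℝ)).indicator f y := fun y => by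
    simp only [Set.indicator_apply, Set.mem_Ici, Subtype.coe_le_coe]
  simp only [h1]
  rw [integral_subtype measurableSet_Icc (f := (Set.Ici (x : ℝ)).indicator f),
    setIntegral_indicator measurableSet_Ici, intervalIntegral.integral_of_le x.2.2,
    ← integral_Icc_eq_integral_Ioc]
  congr 2
  ext t
  have := x.2.1
  simp only [Set.mem_inter_iff, Set.mem_Icc, Set.mem_Ici]
  grind

theorem utility_bid (Q : QuantileStrategy) (x y v : I) :
    utility (Q y) (Q x) v = if x ≤ y then (v : ℝ) - Q y else 0 := by
  simp only [utility, Q.strictMono.le_iff_le]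

/-- The regret of a solution against the competing bids in its range is constant. -/
theorem surplus_bid_eq (hQ : IsSolution F Q) (x : I) :
    surplus F (Q x) = (∫ t in (0 : ℝ)..1, extend Q t) +
      ∫ y : I, utility (Q y) (Q x) (quantile F y) := by
  have hc := Q.continuous_extend
  have hint := intervalIntegrable_quantileReal_sub F hc
  have h1 : ∫ y : I, utility (Q y) (Q x) (quantile F y) =
      ∫ t in (x : ℝ)..1, (quantileReal F t - extend Q t) := by
    rw [← integral_ite_le]
    simp only [utility_bid, quantileReal_coe, Q.extend_coe]
  have h2 := intervalIntegral.integral_add_adjacent_intervals (hint 0 x) (hint x 1)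
  rw [intervalIntegral.integral_sub (a := 0) (b := 1) (intervalIntegrable_quantileReal F _ _)
    (hc.intervalIntegrable _ _), integral_quantileReal] at h2
  rw [surplus_eq_intSurvival, intSurvival_bid hQ, h1]
  linarith

theorem mem_range_bid (hQ : IsSolution F Q) {h : I} (hh : h ≤ Q 1) : ∃ x, Q x = h := by
  have := intermediate_value_univ 0 1 Q.continuous
  rw [hQ.zero] at this
  exact this ⟨unitInterval.nonneg', hh⟩

/-- For competing bids above `Q 1` the strategy never wins, as it earns nothing against `Q 1`
either, and the surplus only decreases in the competing bid. -/
theorem worstRegret_quantileBidding_le (hQ : IsSolution F Q) :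
    worstRegret F (quantileBidding F Q) ≤ ∫ t in (0 : ℝ)..1, extend Q t := by
  refine worstRegret_le F fun h => ?_
  rw [pointUtility_quantileBidding]
  rcases le_or_gt h (Q 1) with hh | hh
  · obtain ⟨x, rfl⟩ := mem_range_bid hQ hh
    rw [surplus_bid_eq hQ, add_sub_cancel_right]
  · have h0 : ∀ y, utility (Q y) h (quantile F y) = 0 := fun y =>
      if_neg (not_le.2 ((Q.strictMono.monotone unitInterval.le_one').trans_lt hh))
    have h1 := surplus_bid_eq hQ 1
    have h2 : ∫ y : I, utility (Q y) (Q 1) (quantile F y) = 0 := by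
      simp only [utility_bid]
      have := integral_ite_le 1 fun t => quantileReal F t - extend Q t
      simp only [quantileReal_coe, Q.extend_coe] at this
      rw [this]
      simp
    have h3 : surplus F h ≤ surplus F (Q 1) := by
      rw [surplus_eq_intSurvival, surplus_eq_intSurvival]
      exact sub_le_sub_left (intSurvival_mono F hh.le) _
    simp only [h0, integral_zero]
    linarith

end

/-! ### The lower bound: a worst-case distribution of competing bids -/

section

/-- A continuous nondecreasing function `M` on `[0, 1]` with `0 ≤ M` and `M 1 = 1` is a CDF. -/
theorem exists_measure_Iic_eq {M : I → ℝ} (hc : Continuous M) (hm : Monotone M)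
    (h0 : ∀ y, 0 ≤ M y) (h1 : M 1 = 1) :
    ∃ ν : Measure I, IsProbabilityMeasure ν ∧ ∀ y, ν.real (Set.Iic y) = M y := by
  -- Push Lebesgue measure forward along the generalized inverse of `M`. A positive value `M 0`
  -- becomes an atom at `0`.
  set g : I → I := fun u => sInf {y : I | (u : ℝ) ≤ M y} with hg
  have hle : ∀ u y, g u ≤ y ↔ (u : ℝ) ≤ M y := fun u y => by
    refine ⟨fun h => ?_, fun h => sInf_le h⟩
    have hcl : IsClosed {y : I | (u : ℝ) ≤ M y} := isClosed_le continuous_const hc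
    have hmem := hcl.csInf_mem ⟨1, by simp [h1, u.2.2]⟩ (OrderBot.bddBelow _)
    exact le_trans hmem (hm h)
  have hgm : Monotone g := fun u w huw =>
    (hle u _).2 ((Subtype.coe_le_coe.2 huw).trans ((hle w _).1 le_rfl))
  refine ⟨volume.map g, Measure.isProbabilityMeasure_map hgm.measurable.aemeasurable, fun y => ?_⟩
  have hM1 : M y ≤ 1 := h1 ▸ hm unitInterval.le_one'
  have hpre : g ⁻¹' Set.Iic y = Set.Iic ⟨M y, h0 y, hM1⟩ := by
    ext u
    exact hle u y
  rw [measureReal_def, Measure.map_apply hgm.measurable measurableSet_Iic, hpre,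
    unitInterval.volume_Iic, ENNReal.toReal_ofReal (h0 y)]

theorem lipschitzOnWith_exp : LipschitzOnWith 1 Real.exp (Set.Iic 0) := by
  refine Convex.lipschitzOnWith_of_nnnorm_deriv_le (fun x _ => Real.differentiableAt_exp)
    (fun x hx => ?_) (convex_Iic 0)
  rw [Real.deriv_exp, ← NNReal.coe_le_coe, coe_nnnorm, Real.norm_of_nonneg (Real.exp_nonneg x)]
  simpa using hx

/-- The growth rate of the CDF of the worst-case competing bids. -/
def growthRate (F : ProbabilityMeasure I) (Q : QuantileStrategy) (t : ℝ) : ℝ :=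
  (1 - cdfReal F (extend Q t))⁻¹

/-- The logarithm of the CDF, in quantile space, of the worst-case competing bids. -/
def logWorstCdf (F : ProbabilityMeasure I) (Q : QuantileStrategy) (t : ℝ) : ℝ :=
  ∫ s in (1 : ℝ)..t, growthRate F Q s

variable {F : ProbabilityMeasure I} {Q : QuantileStrategy}

theorem growthRate_pos (hQ : IsSolution F Q) (t : ℝ) : 0 < growthRate F Q t :=
  inv_pos.2 (one_sub_cdfReal_extend_pos hQ t)

theorem growthRate_mono (hQ : IsSolution F Q) : Monotone (growthRate F Q) := fun _ t h =>
  inv_anti₀ (one_sub_cdfReal_extend_pos hQ t)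
    (sub_le_sub_left (cdfReal_mono F (Q.extend_mono h)) _)

theorem logWorstCdf_mono (hQ : IsSolution F Q) : Monotone (logWorstCdf F Q) := fun s t h => by
  have hint : ∀ a b, IntervalIntegrable (growthRate F Q) volume a b :=
    fun a b => (growthRate_mono hQ).intervalIntegrable
  have h1 := intervalIntegral.integral_interval_sub_left (hint 1 t) (hint 1 s)
  have h2 : 0 ≤ ∫ u in s..t, growthRate F Q u :=
    intervalIntegral.integral_nonneg h fun u _ => (growthRate_pos hQ u).le
  rw [← h1] at h2
  exact sub_nonneg.1 h2

theorem continuous_logWorstCdf (hQ : IsSolution F Q) : Continuous (logWorstCdf F Q) :=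
  intervalIntegral.continuous_primitive (fun _ _ => (growthRate_mono hQ).intervalIntegrable) 1

theorem logWorstCdf_one : logWorstCdf F Q 1 = 0 := intervalIntegral.integral_same

theorem hasDerivAt_logWorstCdf (hQ : IsSolution F Q) {t : ℝ}
    (ht : ContinuousAt (growthRate F Q) t) :
    HasDerivAt (logWorstCdf F Q) (growthRate F Q t) t :=
  intervalIntegral.integral_hasDerivAt_right (growthRate_mono hQ).intervalIntegrable
    (growthRate_mono hQ).measurable.stronglyMeasurable.stronglyMeasurableAtFilter ht

/-- Against the worst-case competing bids, `Q y` is a best response of the value `F⁻(y)` among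
the bids in the range of `Q`. -/
theorem sub_mul_exp_logWorstCdf_le (hQ : IsSolution F Q) (y z : I) :
    ((quantile F y : ℝ) - Q z) * Real.exp (logWorstCdf F Q z) ≤
      ((quantile F y : ℝ) - Q y) * Real.exp (logWorstCdf F Q y) := by
  have hK : AbsolutelyContinuousOnInterval (logWorstCdf F Q) 0 1 :=
    IntervalIntegrable.absolutelyContinuousOnInterval_intervalIntegral
      (growthRate_mono hQ).intervalIntegrable Set.right_mem_uIcc
  have hM : AbsolutelyContinuousOnInterval (Real.exp ∘ logWorstCdf F Q) 0 1 :=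
    absolutelyContinuousOnInterval_comp_of_lipschitzOnWith lipschitzOnWith_exp hK fun t ht => by
      rw [Set.uIcc_of_le zero_le_one] at ht
      exact (logWorstCdf_mono hQ ht.2).trans_eq logWorstCdf_one
  have hconst : AbsolutelyContinuousOnInterval (fun _ : ℝ => (quantile F y : ℝ)) 0 1 :=
    (LipschitzWith.const _).lipschitzOnWith.absolutelyContinuousOnInterval
  have hφ := (hconst.sub Q.absolutelyContinuous).mul hM
  -- The equation gives `Q' = (F⁻ - Q) g` with `g` the growth rate of `M`, so the terms in `Q`
  -- cancel and the derivative is `M g (F⁻(y) - F⁻(t))`. Its sign changes at `t = y` by monotonicity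
  -- of `F⁻`.
  have hd : ∀ᵐ t : ℝ, t ∈ Set.Icc (0 : ℝ) 1 →
      HasDerivAt (((fun _ : ℝ => (quantile F y : ℝ)) - extend Q) * (Real.exp ∘ logWorstCdf F Q))
        (Real.exp (logWorstCdf F Q t) * growthRate F Q t *
          (quantileReal F y - quantileReal F t)) t := by
    filter_upwards [ae_hasDerivAt_extend hQ,
      (growthRate_mono hQ).countable_not_continuousAt.ae_notMem volume] with t ht htc htI
    obtain ⟨-, h2⟩ := ht htI
    have h3 := (hasDerivAt_logWorstCdf hQ (not_not.1 htc)).exp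
    refine ((h2.const_sub (quantile F y : ℝ)).mul h3).congr_deriv ?_
    rw [quantileReal_coe, growthRate]
    simp only [div_eq_mul_inv]
    ring
  have key := eq_add_integral_of_absolutelyContinuousOnInterval hφ hd z.2 y.2
  simp only [Pi.mul_apply, Pi.sub_apply, Function.comp_apply, Q.extend_coe] at key
  rw [← sub_nonneg, ← key]
  have hw : ∀ t, 0 ≤ Real.exp (logWorstCdf F Q t) * growthRate F Q t := fun t =>
    mul_nonneg (Real.exp_nonneg _) (growthRate_pos hQ t).le
  rcases le_total (z : ℝ) y with h | h
  · exact intervalIntegral.integral_nonneg h fun t ht =>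
      mul_nonneg (hw t) (sub_nonneg.2 (quantileReal_mono F ht.2))
  · rw [intervalIntegral.integral_symm, ← intervalIntegral.integral_neg]
    exact intervalIntegral.integral_nonneg h fun t ht => neg_nonneg.2
      (mul_nonpos_of_nonneg_of_nonpos (hw t) (sub_nonpos.2 (quantileReal_mono F ht.1)))

theorem integral_utility_eq (Q : QuantileStrategy) (ν : Measure I) (b v : I) :
    ∫ x, utility b (Q x) v ∂ν = ((v : ℝ) - b) * ν.real {x | Q x ≤ b} := by
  have : (fun x => utility b (Q x) v) = {x | Q x ≤ b}.indicator fun _ => (v : ℝ) - b := by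
    ext x
    simp [utility, Set.indicator_apply]
  rw [this, integral_indicator (measurableSet_le Q.measurable measurable_const),
    setIntegral_const, smul_eq_mul, mul_comm]

/-- There is a distribution of competing bids against which the quantile-based strategy is a best
response. -/
theorem exists_measure_integral_utility_le (hQ : IsSolution F Q) :
    ∃ ν : Measure I, IsProbabilityMeasure ν ∧ ∀ y b : I,
      ∫ x, utility b (Q x) (quantile F y) ∂ν ≤ ∫ x, utility (Q y) (Q x) (quantile F y) ∂ν := by
  obtain ⟨ν, hν, hM⟩ := exists_measure_Iic_eq (M := fun y : I => Real.exp (logWorstCdf F Q y))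
    (Real.continuous_exp.comp ((continuous_logWorstCdf hQ).comp continuous_subtype_val))
    (fun s t h => Real.exp_le_exp.2 (logWorstCdf_mono hQ h)) (fun _ => Real.exp_nonneg _)
    (by simp [logWorstCdf_one])
  have hset : ∀ z, {x | Q x ≤ Q z} = Set.Iic z := fun z => by
    ext x
    exact Q.strictMono.le_iff_le
  refine ⟨ν, hν, fun y b => ?_⟩
  simp only [integral_utility_eq, hset, hM]
  rcases le_or_gt b (Q 1) with hb | hb
  · obtain ⟨z, rfl⟩ := mem_range_bid hQ hb
    rw [hset, hM]
    exact sub_mul_exp_logWorstCdf_le hQ y z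
  -- A bid above `Q 1` wins surely, as does `Q 1`, but at a higher price.
  · have huniv : {x | Q x ≤ b} = Set.univ := Set.eq_univ_of_forall fun x =>
      (Q.strictMono.monotone unitInterval.le_one').trans hb.le
    have h1 := sub_mul_exp_logWorstCdf_le hQ y 1
    have h2 : (Q 1 : ℝ) ≤ b := hb.le
    simp only [Set.Icc.coe_one, logWorstCdf_one, Real.exp_zero, mul_one] at h1
    rw [huniv, probReal_univ, mul_one]
    linarith

/-- Average the regret of `s` against `Q x` over `x ∼ ν`. Since `s` earns on average no more than
the solution, whose regret is `∫ Q` at each `x`, this average is at least `∫ Q`. -/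
theorem le_worstRegret (hQ : IsSolution F Q) (s : Strategy) :
    ∫ t in (0 : ℝ)..1, extend Q t ≤ worstRegret F s := by
  obtain ⟨ν, hν, hbest⟩ := exists_measure_integral_utility_le hQ
  set R := ∫ t in (0 : ℝ)..1, extend Q t with hR
  have hq := (quantile_mono F).measurable
  have hQm := Q.measurable
  have hm1 : Measurable fun p : I × I => utility (Q p.2) (Q p.1) (quantile F p.2) :=
    measurable_utility.comp ((hQm.comp measurable_snd).prodMk
      ((hQm.comp measurable_fst).prodMk (hq.comp measurable_snd)))
  have hi1 : Integrable (fun p : I × I => utility (Q p.2) (Q p.1) (quantile F p.2))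
      (ν.prod volume) := integrable_of_abs_le_one hm1 fun p => abs_utility_le _ _ _
  have hm2 : Measurable fun p : I × I => valueUtility s (quantile F p.2) (Q p.1) :=
    (measurable_valueUtility s).comp ((hq.comp measurable_snd).prodMk (hQm.comp measurable_fst))
  have hi2 : Integrable (fun p : I × I => valueUtility s (quantile F p.2) (Q p.1))
      (ν.prod volume) := integrable_of_abs_le_one hm2 fun p => abs_valueUtility_le _ _ _
  have hpoint : ∀ x, pointUtility F s (Q x) = ∫ y : I, valueUtility s (quantile F y) (Q x) :=
    fun x => integral_eq_integral_quantile F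
      ((measurable_valueUtility s).comp (measurable_id.prodMk measurable_const))
  have hx : ∀ x, R + (∫ y : I, utility (Q y) (Q x) (quantile F y)) -
      ∫ y : I, valueUtility s (quantile F y) (Q x) ≤ worstRegret F s := fun x => by
    rw [← hpoint, ← surplus_bid_eq hQ]
    exact surplus_sub_le_worstRegret F s (Q x)
  have hswap1 := integral_integral_swap (f := fun x y => utility (Q y) (Q x) (quantile F y)) hi1
  have hswap2 := integral_integral_swap (f := fun x y => valueUtility s (quantile F y) (Q x)) hi2
  have h1 := hi1.integral_prod_left
  have h2 := hi2.integral_prod_left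
  have havg := integral_mono (((integrable_const R).add h1).sub h2)
    (integrable_const (worstRegret F s)) hx
  rw [integral_sub' ((integrable_const R).add h1) h2, integral_add' (integrable_const R) h1,
    integral_const, integral_const, probReal_univ, one_smul, one_smul, hswap1, hswap2] at havg
  have hle : ∫ y : I, ∫ x, valueUtility s (quantile F y) (Q x) ∂ν ≤
      ∫ y : I, ∫ x, utility (Q y) (Q x) (quantile F y) ∂ν := by
    refine integral_mono hi2.integral_prod_right hi1.integral_prod_right fun y => ?_
    have hm3 : Measurable fun p : I × I => utility p.2 (Q p.1) (quantile F y) :=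
      measurable_utility.comp (measurable_snd.prodMk
        ((hQm.comp measurable_fst).prodMk measurable_const))
    have hi3 : Integrable (fun p : I × I => utility p.2 (Q p.1) (quantile F y))
        (ν.prod (s.1 (quantile F y))) :=
      integrable_of_abs_le_one hm3 fun p => abs_utility_le _ _ _
    have h4 := integral_integral_swap (f := fun x b => utility b (Q x) (quantile F y)) hi3
    simp only [valueUtility]
    rw [h4]
    have h5 := integral_mono hi3.integral_prod_right
      (integrable_const (∫ x, utility (Q y) (Q x) (quantile F y) ∂ν)) fun b => hbest y b
    rwa [integral_const, probReal_univ, one_smul] at h5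
  linarith

theorem isMinimaxOptimal_quantileBidding (hQ : IsSolution F Q) :
    IsMinimaxOptimal F (quantileBidding F Q) := fun s =>
  (worstRegret_quantileBidding_le hQ).trans (le_worstRegret hQ s)

theorem minimaxRegret_eq_of_isMinimaxOptimal {s : Strategy} (hs : IsMinimaxOptimal F s) :
    minimaxRegret F = worstRegret F s :=
  le_antisymm (ciInf_le ⟨worstRegret F s, by rintro _ ⟨s', rfl⟩; exact hs s'⟩ s) (le_ciInf hs)

end

end FirstPrice

end

theorem mainTheorem7 (Ft F : MeasureTheory.ProbabilityMeasure unitInterval) (a : ℝ)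
    (ha : (Ft : MeasureTheory.Measure unitInterval).real {0} = a) (ha1 : a < 1)
    (hF : F = FirstPrice.condPos Ft (ha.trans_lt ha1)) :
    (∃ Q : FirstPrice.QuantileStrategy, FirstPrice.IsSolution F Q) ∧
    ∀ Q : FirstPrice.QuantileStrategy, FirstPrice.IsSolution F Q →
      FirstPrice.IsMinimaxOptimal F (FirstPrice.quantileBidding F Q) ∧
      FirstPrice.IsMinimaxOptimal Ft
        (FirstPrice.bidZeroAtZero (FirstPrice.quantileBidding F Q)) ∧
      FirstPrice.worstRegret Ft
          (FirstPrice.bidZeroAtZero (FirstPrice.quantileBidding F Q)) =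
        FirstPrice.minimaxRegret Ft ∧
      FirstPrice.minimaxRegret Ft =
        (1 - a) * FirstPrice.worstRegret F (FirstPrice.quantileBidding F Q) := by
  subst ha
  subst hF
  refine ⟨FirstPrice.exists_isSolution (FirstPrice.cdf_condPos_zero ha1), fun Q hQ => ?_⟩
  have hopt := FirstPrice.isMinimaxOptimal_quantileBidding hQ
  have hup := FirstPrice.worstRegret_bidZeroAtZero_le ha1
    (FirstPrice.quantileBidding (FirstPrice.condPos Ft ha1) Q)
  -- Optimality for the conditioned distribution is transferred to an arbitrary strategy for `Ft`;
  -- this matches `hup`, so both bounds are tight.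
  have hlow : ∀ s, (1 - (Ft : MeasureTheory.Measure unitInterval).real {0}) *
      FirstPrice.worstRegret (FirstPrice.condPos Ft ha1)
        (FirstPrice.quantileBidding (FirstPrice.condPos Ft ha1) Q) ≤
      FirstPrice.worstRegret Ft s := fun s =>
    (mul_le_mul_of_nonneg_left (hopt s) (sub_pos.2 ha1).le).trans
      (FirstPrice.mul_worstRegret_condPos_le ha1 s)
  have hoptT : FirstPrice.IsMinimaxOptimal Ft (FirstPrice.bidZeroAtZero
      (FirstPrice.quantileBidding (FirstPrice.condPos Ft ha1) Q)) := fun s => hup.trans (hlow s)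
  have hmin := FirstPrice.minimaxRegret_eq_of_isMinimaxOptimal hoptT
  exact ⟨hopt, hoptT, hmin.symm, hmin.trans (le_antisymm hup (hlow _))⟩
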